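/- Let $A=\{\mathbf a_1,\dots,\mathbf a_m\}\subseteq\mathbb Z^n$ be linearly independent over $\mathbb R$, and let $\mathbf a_0\in\mathbb Z^n$ lie in the relative interior of the convex hull of $A$; equivalently, there are (unique) positive integers $\ell_0,\dots,\ell_m$ with greatest common divisor $1$, $\ell_0=\sum_{j=1}^m\ell_j$ and $\ell_0\mathbf a_0=\sum_{j=1}^m\ell_j\mathbf a_j$. Let $V\subseteq\mathbb R^n$ be the real span of $A$ and $V_{\mathbb Z}=V\cap\mathbb Z^n$. For $B\subseteq A$ let $C(B)$ be the real cone generated by $B$, and let $P(A)=\{\sum_j c_j\mathbf a_j : 0\le c_j<1\}$. Interiors of $C(A)$ and $P(A)$ are taken in $V$. Put $M=V_{\mathbb Z}\cap C(A)$ and $\mathcal B=V_{\mathbb Z}\cap P(A)$ (a finite set), and let $\mathbb ZA_+$ be the group generated by $\mathbf a_0,\mathbf a_1,\dots,\mathbf a_m$. Let $\lambda$ be an indeterminate and put $$f_\lambda=\sum_{j=1}^m\ell_jx^{\mathbf a_j}-\ell_0\lambda x^{\mathbf a_0},\qquad D_i=x_i\frac{\partial}{\partial x_i}+x_i\frac{\partial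 f_\lambda}{\partial x_i}\quad(i=1,\dots,n),$$ operators on the $\mathbb C(\lambda)$-algebra $S'$ with basis $\{x^u: u\in M\}$. Let $\alpha$ be the $n\times m$ matrix with columns $\mathbf a_j$, let $\beta=(\beta_{ji})$ be any rational $m\times n$ matrix with $\beta\alpha=I_m$, and put $\tilde D_j=\sum_{i=1}^n\beta_{ji}D_i$ for $j=1,\dots,m$. Let $\mathrm{Kos}^\bullet$ be the Koszul complex of $\tilde D_1,\dots,\tilde D_m$ on $S'$: $\mathrm{Kos}^k=\bigoplus_{j_1<\dots<j_k}S'\,e_{j_1}\wedge\dots\wedge e_{j_k}$, with differential $\xi\,e_{j_1}\wedge\dots\wedge e_{j_k}\mapsto\sum_{j}\tilde D_j(\xi)\,e_j\wedge e_{j_1}\wedge\dots\wedge e_{j_k}$. For $J\subseteq\{1,\dots,m\}$ let $S'_{A,J}\subseteq S'$ be the $\mathbb C(\lambda)$-span of the $x^u$, $u=\sum_jc_j\mathbf a_j\in M$, with $c_j>0$ for all $j\in J$, and put $$\mathcal K^k(A,A)=\bigoplus_{j_1<\dots<j_k}S'_{A,\{j_1,\dots,j_k\}}\,e_{j_1}\wedge\dots\wedge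 e_{j_k}.$$ Then $\mathcal K^\bullet(A,A)$ is a subcomplex of the complex $\mathrm{Kos}^\bullet$, and 1. $H^i(\mathcal K^\bullet(A,A))=0$ for $0\le i<m$; 2. $H^m(\mathcal K^\bullet(A,A))$ is finite-dimensional over $\mathbb C(\lambda)$, and $$\dim_{\mathbb C(\lambda)}H^m(\mathcal K^\bullet(A,A))=\sum_{B\subseteq A}(-1)^{|A\setminus B|}\,|\mathcal B\cap C(B)|,$$ which equals the number of points of $\mathcal B$ in the interior of $C(A)$; 3. for every coset $\mathcal C$ of $\mathbb ZA_+$ in $V_{\mathbb Z}$, let $S'_{\mathcal C}$ be the $\mathbb C(\lambda)$-span of the $x^u$ with $u\in M\cap\mathcal C$, let $\mathcal W'_{\mathcal C}=S'_{\mathcal C}/\sum_{i=1}^nD_iS'_{\mathcal C}$, and let $\widehat{\mathcal W}_{\mathcal C}\subseteq\mathcal W'_{\mathcal C}$ be the subspace spanned by the classes of the $x^u$ with $u\in M\cap\mathcal C$ in the interior of $C(A)$. Then $\dim_{\mathbb C(\lambda)}\widehat{\mathcal W}_{\mathcal C}=R_{\mathcal C}$, the number of points of $\mathcal B\cap\mathcal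 C$ in the interior of $P(A)$. -/

import Mathlib

open scoped BigOperators

noncomputable section

namespace Delsarte

/-- The field `ℂ(λ)`; the indeterminate `λ` is `RatFunc.X`. -/
abbrev K : Type := RatFunc ℂ

/-- The Laurent polynomial ring `ℂ(λ)[x₁^{±1}, …, xₙ^{±1}]`. -/
abbrev Laurent (n : ℕ) : Type := AddMonoidAlgebra K (Fin n → ℤ)

/-- The monomial `x^u`. -/
def mono {n : ℕ} (u : Fin n → ℤ) : Laurent n := AddMonoidAlgebra.single u 1

/-- The Euler operator `x_i ∂/∂x_i`, the `ℂ(λ)`-linear map with `x^u ↦ u_i x^u`. -/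
def euler {n : ℕ} (i : Fin n) : Laurent n →ₗ[K] Laurent n :=
  (Finsupp.lsum K fun u : Fin n → ℤ => ((u i : ℤ) : K) • AddMonoidAlgebra.lsingle (R := K) u) ∘ₗ
    (AddMonoidAlgebra.coeffLinearEquiv (S := K) (M := Fin n → ℤ) K).toLinearMap

theorem euler_mono {n : ℕ} (i : Fin n) (u : Fin n → ℤ) :
    euler i (mono u) = ((u i : ℤ) : K) • mono u := by
  simp [euler, mono]

/-- The inclusion of `ℤⁿ` in `ℝⁿ`. -/
def toReal {n : ℕ} (u : Fin n → ℤ) : Fin n → ℝ := fun i => (u i : ℝ)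

/-- The data: exponent vectors `a₁, …, a_m ∈ ℤⁿ`, linearly independent over `ℝ`, and a lattice
point `a₀` with `ℓ₀ a₀ = ∑ ℓ_j a_j`, where `ℓ₀ = ∑ ℓ_j` and `ℓ₀, …, ℓ_m` are positive integers with
greatest common divisor one.  Such a relation exists (and is then unique) if and only if `a₀` lies
in the relative interior of the convex hull of `{a₁, …, a_m}`. -/
structure Data (m n : ℕ) where
  a : Fin m → Fin n → ℤ
  linInd : LinearIndependent ℝ fun j => toReal (a j)
  a₀ : Fin n → ℤ
  l : Fin m → ℕ
  l₀ : ℕ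
  l_pos : ∀ j, 0 < l j
  l₀_pos : 0 < l₀
  gcd_eq_one : Nat.gcd l₀ (Finset.univ.gcd l) = 1
  relation : l₀ • a₀ = ∑ j, l j • a j
  l₀_eq_sum : l₀ = ∑ j, l j

namespace Data

variable {m n : ℕ} (P : Data m n)

/-- The real vector space `V ⊆ ℝⁿ` spanned by `A = {a₁, …, a_m}`. -/
def V : Submodule ℝ (Fin n → ℝ) := Submodule.span ℝ (Set.range fun j => toReal (P.a j))

/-- The lattice `V_ℤ = V ∩ ℤⁿ`. -/
def VZ : Set (Fin n → ℤ) := {u | toReal u ∈ P.V}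

/-- The real cone `C(B)` generated by a subset `B` of `A` (given by its set of indices). -/
def cone (B : Finset (Fin m)) : Set (Fin n → ℝ) :=
  {x | ∃ c : Fin m → ℝ, (∀ j ∈ B, 0 ≤ c j) ∧ x = ∑ j ∈ B, c j • toReal (P.a j)}

/-- The half-open parallelepiped `P(A)`. -/
def parallelepiped : Set (Fin n → ℝ) :=
  {x | ∃ c : Fin m → ℝ, (∀ j, 0 ≤ c j ∧ c j < 1) ∧ x = ∑ j, c j • toReal (P.a j)}

/-- The topological interior, relative to the space `V`, of a subset `X` of `V`. -/
def interiorInV (X : Set (Fin n → ℝ)) : Set (Fin n → ℝ) :=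
  (fun v : P.V => (v : Fin n → ℝ)) '' interior {v : P.V | (v : Fin n → ℝ) ∈ X}

/-- `M = V_ℤ ∩ C(A)`. -/
def M : Set (Fin n → ℤ) := {u | u ∈ P.VZ ∧ toReal u ∈ P.cone Finset.univ}

/-- `𝓑 = V_ℤ ∩ P(A)`. -/
def latticeB : Set (Fin n → ℤ) := {u | u ∈ P.VZ ∧ toReal u ∈ P.parallelepiped}

/-- The subgroup `ℤA₊` generated by `a₀, a₁, …, a_m`. -/
def ZAplus : AddSubgroup (Fin n → ℤ) := AddSubgroup.closure (insert P.a₀ (Set.range P.a))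

/-- `f_λ = ∑ ℓ_j x^{a_j} - ℓ₀ λ x^{a₀}`. -/
def f : Laurent n :=
  ∑ j, (P.l j : K) • mono (P.a j) - ((P.l₀ : K) * RatFunc.X) • mono P.a₀

/-- `D_i = x_i ∂/∂x_i + x_i ∂f_λ/∂x_i`. -/
def D (i : Fin n) : Laurent n →ₗ[K] Laurent n :=
  euler i + LinearMap.mulLeft K (euler i P.f)

/-- The `n × m` matrix with columns `a_j`. -/
def alpha : Matrix (Fin n) (Fin m) ℚ := Matrix.of fun i j => (P.a j i : ℚ)

/-- `D̃_j = ∑ᵢ β_{ji} D_i` for `j = 1, …, m`, where `β` is a rational `m × n` matrix with `β α = 1`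
(these are the first `m` rows of an invertible `n × n` matrix carrying `α` to `(1, 0)ᵀ`). -/
def Dtilde (β : Matrix (Fin m) (Fin n) ℚ) (j : Fin m) : Laurent n →ₗ[K] Laurent n :=
  ∑ i, ((β j i : ℚ) : K) • P.D i

/-- The `ℂ(λ)`-space spanned by the `x^u`, `u = ∑ c_j a_j ∈ M`, for which `c_j > 0` for every
`j ∈ J`.  For `J = ∅` this is the ring `S'`. -/
def S (J : Finset (Fin m)) : Submodule K (Laurent n) :=
  Submodule.span K (mono '' {u | u ∈ P.M ∧
    ∃ c : Fin m → ℝ, toReal u = ∑ j, c j • toReal (P.a j) ∧ ∀ j ∈ J, 0 < c j})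

end Data

/-- The differential of the Koszul complex of operators `φ₁, …, φ_m` on `L`.  A cochain
`∑_J ξ_J e_J`, with `e_J = e_{j₁} ∧ ⋯ ∧ e_{j_k}` for `J = {j₁ < ⋯ < j_k}`, is the function
`J ↦ ξ_J`, and `ξ e_I ↦ ∑_j φ_j(ξ) e_j ∧ e_I`. -/
def koszulD {m : ℕ} {L : Type*} [AddCommGroup L] [Module K L] (φ : Fin m → L →ₗ[K] L) :
    (Finset (Fin m) → L) →ₗ[K] (Finset (Fin m) → L) :=
  LinearMap.pi fun J => ∑ j ∈ J,
    ((-1 : K) ^ (J.filter (· < j)).card) • (φ j ∘ₗ LinearMap.proj (J.erase j))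

/-- The cochains of degree `k` whose `e_J`-component lies in the subspace `N J`. -/
def koszulCochains {m : ℕ} {L : Type*} [AddCommGroup L] [Module K L]
    (N : Finset (Fin m) → Submodule K L) (k : ℕ) : Submodule K (Finset (Fin m) → L) :=
  Submodule.pi Set.univ fun J => if J.card = k then N J else ⊥

namespace Data

variable {m n : ℕ} (P : Data m n)

/-- The differential `∇` of the Koszul complex of `D̃₁, …, D̃_m`. -/
def nabla (β : Matrix (Fin m) (Fin n) ℚ) :
    (Finset (Fin m) → Laurent n) →ₗ[K] (Finset (Fin m) → Laurent n) :=
  koszulD (P.Dtilde β)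

/-- `Kosᵏ(S', {D̃_j})`. -/
def kos (k : ℕ) : Submodule K (Finset (Fin m) → Laurent n) := koszulCochains (fun _ => P.S ∅) k

/-- `𝒦ᵏ(A, A)`. -/
def kAA (k : ℕ) : Submodule K (Finset (Fin m) → Laurent n) := koszulCochains P.S k

/-- The cocycles of degree `k` of `𝒦(A, A)`. -/
def cocycles (β : Matrix (Fin m) (Fin n) ℚ) (k : ℕ) :
    Submodule K (Finset (Fin m) → Laurent n) :=
  P.kAA k ⊓ LinearMap.ker (P.nabla β)

/-- The coboundaries of degree `k` of `𝒦(A, A)`: the image of `𝒦ᵏ⁻¹(A, A)`, zero if `k = 0`. -/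
def coboundaries (β : Matrix (Fin m) (Fin n) ℚ) :
    ℕ → Submodule K (Finset (Fin m) → Laurent n)
  | 0 => ⊥
  | k + 1 => (P.kAA k).map (P.nabla β)

/-- The cohomology `Hᵏ(𝒦(A, A))`. -/
abbrev H (β : Matrix (Fin m) (Fin n) ℚ) (k : ℕ) : Type :=
  P.cocycles β k ⧸ (P.coboundaries β k).submoduleOf (P.cocycles β k)

/-- `M ∩ 𝒞` for the coset `𝒞 = c + ℤA₊`. -/
def Mcoset (c : Fin n → ℤ) : Set (Fin n → ℤ) := {u | u ∈ P.M ∧ u - c ∈ P.ZAplus}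

/-- The span of the `x^u`, `u ∈ M ∩ (c + ℤA₊)`. -/
def Scoset (c : Fin n → ℤ) : Submodule K (Laurent n) := Submodule.span K (mono '' (P.Mcoset c))

/-- `∑ᵢ D_i S'_𝒞`, a subspace of `S'_𝒞`. -/
def relCoset (c : Fin n → ℤ) : Submodule K (Laurent n) := ⨆ i, (P.Scoset c).map (P.D i)

/-- `𝒲'_𝒞 = S'_𝒞 / ∑ᵢ D_i S'_𝒞`. -/
abbrev Wcoset (c : Fin n → ℤ) : Type := P.Scoset c ⧸ (P.relCoset c).submoduleOf (P.Scoset c)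

/-- The subspace of `𝒲'_𝒞` spanned by the classes of the `x^u` with `u` in the interior of `C(A)`. -/
def What (c : Fin n → ℤ) : Submodule K (P.Wcoset c) :=
  Submodule.span K (((P.relCoset c).submoduleOf (P.Scoset c)).mkQ ''
    {s : P.Scoset c | ∃ u ∈ P.Mcoset c, toReal u ∈ P.interiorInV (P.cone Finset.univ) ∧
      (s : Laurent n) = mono u})

/-- The number `R_𝒞` of points of `𝓑 ∩ (c + ℤA₊)` in the interior of `P(A)`. -/
def R (c : Fin n → ℤ) : ℕ :=
  {b | b ∈ P.latticeB ∧ b - c ∈ P.ZAplus ∧ toReal b ∈ P.interiorInV P.parallelepiped}.ncard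

end Data

end Delsarte

end

/-! Write $c_j(u)$ for the coordinates of $u$ with respect to $A$. Then $\tilde D_j
x^u=c_j(u)x^u+\ell_jx^{u+\mathbf a_j}-\lambda\ell_jx^{u+\mathbf a_0}$, and the whole proof is a
perturbation in $\lambda$ from $\lambda=0$.

At $\lambda=0$ the operator `Dzero` in direction $j$ moves only the coordinate $c_j$. It has a left
inverse `Dinv`, which vanishes on monomials with $0\le c_j<1$ and commutes with the operators of the
other directions. Contracting with `Dinv` in each direction and composing the homotopies gives $h$
with $\nabla_0h+h\nabla_0=1-p$, where $p$ lives in top degree and has values in the span of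
monomials with all $c_j<1$.

Let $\nabla=\nabla_0-\lambda E$. The same $h$ satisfies $\nabla h+h\nabla+p=\Phi$ with
$\Phi=1-\lambda(Eh+hE)$ (`nabla_homotopy`). The operator $Eh+hE$ is rational and preserves
finite-dimensional rational spaces exhausting the complex, cut out by $\sum_jc_j\le d+|J|$ on the
$e_J$-component. Since $\det(1-\lambda N)\ne0$ for every rational matrix $N$, $\Phi$ is bijective on
cochains of each degree. Hence cohomology vanishes below degree $m$ (`exists_nabla_eq`), every top
cochain is cohomologous to a combination of box monomials (`exists_sub_nabla_mem`), and no nonzero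
such combination is a coboundary (`eq_zero_of_single_eq_nabla`).

All this is done with exponents in a set $\Gamma$ stable under $\mathbb ZA_+$ and with positivity
imposed only at indices in $Z$. Full $Z$ gives $\mathcal K(A,A)$, empty $Z$ the Koszul complex on
$S'$. For a coset, reduction to the box with full $Z$ spans $\widehat{\mathcal W}_{\mathcal C}$, and
independence with empty $Z$ shows that no relation appears in the larger quotient. The alternating
sum is inclusion–exclusion over the vanishing coordinates. -/

noncomputable section

namespace Delsarte

/-! ### Perturbations by the indeterminate -/

section Perturbation

variable {W : Type*} [AddCommGroup W] [Module K W] [Module ℚ W]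

theorem ratCast_smul_eq (q : ℚ) (x : W) : (q : K) • x = q • x := by
  simpa using map_ratCast_smul (AddMonoidHom.id W) K ℚ q x

theorem ratSpan_subset_span (s : Set W) :
    (Submodule.span ℚ s : Set W) ⊆ Submodule.span K s := by
  intro x hx
  induction hx using Submodule.span_induction with
  | mem x hx => exact Submodule.subset_span hx
  | zero => exact Submodule.zero_mem _
  | add x y _ _ hx hy => exact Submodule.add_mem _ hx hy
  | smul q x _ hx =>
    rw [← ratCast_smul_eq]
    exact Submodule.smul_mem _ _ hx

theorem apply_mem_of_mem_ratSpan {T : W →ₗ[K] W} {s : Set W} {N : Submodule ℚ W}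
    (h : ∀ x ∈ s, T x ∈ N) {x : W} (hx : x ∈ Submodule.span ℚ s) : T x ∈ N := by
  induction hx using Submodule.span_induction with
  | mem x hx => exact h x hx
  | zero => rw [map_zero]; exact N.zero_mem
  | add x y _ _ hx hy => rw [map_add]; exact N.add_mem hx hy
  | smul q x _ hx => rw [map_rat_smul]; exact N.smul_mem _ hx

/-- The determinant is a polynomial in $\lambda$ (the reversed characteristic polynomial) whose
value at $\lambda=0$ is $1$. -/
theorem det_one_sub_X_smul_ne_zero {r : ℕ} (M : Matrix (Fin r) (Fin r) ℚ) :
    (1 - (RatFunc.X : K) • M.map (fun q : ℚ => (q : K))).det ≠ 0 := by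
  set N : Matrix (Fin r) (Fin r) ℂ := M.map (fun q : ℚ => (q : ℂ)) with hN
  have h1 : N.charpolyRev ≠ 0 := by
    intro h0
    have := Matrix.eval_charpolyRev (M := N)
    rw [h0] at this
    simp at this
  have h2 : (1 - (RatFunc.X : K) • M.map (fun q : ℚ => (q : K))).det =
      algebraMap (Polynomial ℂ) K N.charpolyRev := by
    rw [Matrix.charpolyRev, RingHom.map_det]
    congr 1
    ext i j
    by_cases hij : i = j
    · subst hij
      simp [hN, RatFunc.algebraMap_X, mul_comm (RatFunc.X : K)]
    · simp [hN, RatFunc.algebraMap_X, hij, mul_comm (RatFunc.X : K)]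
  rw [h2]
  exact fun h => h1 (RatFunc.algebraMap_injective ℂ (by simpa using h))

/-- On a finite generating family of $G$ the operator acts through a matrix $1-\lambda N$ with $N$
rational, and the inverse matrix writes down preimages of the generators. Linear independence of the
family is not needed. -/
theorem span_le_map_one_sub_X_smul {G : Submodule ℚ W} (hG : G.FG) {T : W →ₗ[K] W}
    (hT : ∀ x ∈ G, T x ∈ G) :
    Submodule.span K (G : Set W) ≤
      (Submodule.span K (G : Set W)).map (1 - (RatFunc.X : K) • T) := by
  obtain ⟨r, s, hs⟩ := Submodule.fg_iff_exists_fin_generating_family.1 hG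
  have hsG : ∀ i, s i ∈ G := fun i => hs ▸ Submodule.subset_span ⟨i, rfl⟩
  have hc : ∀ i, ∃ c : Fin r → ℚ, ∑ j, c j • s j = T (s i) := fun i => by
    have := hT _ (hsG i)
    rw [← hs] at this
    exact (Submodule.mem_span_range_iff_exists_fun ℚ).1 this
  choose c hc using hc
  set A : Matrix (Fin r) (Fin r) K :=
    1 - (RatFunc.X : K) • (Matrix.of c).map (fun q : ℚ => (q : K)) with hA
  have hdet : IsUnit A.det := (det_one_sub_X_smul_ne_zero _).isUnit
  have hrat : ∀ (q : ℚ) (x : W), q • x = (q : K) • x := fun q x =>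
    (ratCast_smul_eq q x).symm
  have hPhi : ∀ i, (1 - (RatFunc.X : K) • T) (s i) = ∑ j, A i j • s j := fun i => by
    simp only [hA, Matrix.sub_apply, sub_smul, Finset.sum_sub_distrib, Matrix.smul_apply,
      Matrix.map_apply, Matrix.of_apply, smul_assoc, ← Finset.smul_sum]
    simp only [← hrat, hc]
    simp [Matrix.one_apply]
  rw [Submodule.span_le]
  have key : ∀ i, s i ∈
      (Submodule.span K (G : Set W)).map (1 - (RatFunc.X : K) • T) := fun i => by
    refine ⟨∑ j, A⁻¹ i j • s j, Submodule.sum_mem _ fun j _ =>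
      Submodule.smul_mem _ _ (Submodule.subset_span (hsG j)), ?_⟩
    rw [map_sum]
    simp only [map_smul, hPhi, Finset.smul_sum, smul_smul]
    rw [Finset.sum_comm]
    simp only [← Finset.sum_smul, ← Matrix.mul_apply, Matrix.nonsing_inv_mul A hdet]
    simp [Matrix.one_apply]
  intro x hx
  have h3 : x ∈ Submodule.span ℚ (Set.range s) := hs ▸ hx
  obtain ⟨d, rfl⟩ := (Submodule.mem_span_range_iff_exists_fun ℚ).1 h3
  refine Submodule.sum_mem _ fun i _ => ?_
  rw [hrat]
  exact Submodule.smul_mem _ _ (key i)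

theorem map_span_le_span {G G' : Submodule ℚ W} {T : W →ₗ[K] W} (hT : ∀ x ∈ G, T x ∈ G') :
    (Submodule.span K (G : Set W)).map T ≤ Submodule.span K (G' : Set W) := by
  rw [Submodule.map_span, Submodule.span_le]
  rintro _ ⟨x, hx, rfl⟩
  exact Submodule.subset_span (hT x hx)

theorem span_finite_of_fg {G : Submodule ℚ W} (hG : G.FG) :
    (Submodule.span K (G : Set W)).FG := by
  obtain ⟨s, hs⟩ := hG
  refine ⟨s, le_antisymm (Submodule.span_mono (hs ▸ Submodule.subset_span)) ?_⟩
  rw [Submodule.span_le, ← hs]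
  exact ratSpan_subset_span _

/-- The union of the `K`-spans of an increasing sequence of rational subspaces. -/
def unionSpan (G : ℕ → Submodule ℚ W) : Submodule K W := ⨆ d, Submodule.span K (G d : Set W)

theorem mem_unionSpan {G : ℕ → Submodule ℚ W} (hG : Monotone G) {x : W} :
    x ∈ unionSpan G ↔ ∃ d, x ∈ Submodule.span K (G d : Set W) :=
  Submodule.mem_iSup_of_directed _
    (Monotone.directed_le fun _ _ h => Submodule.span_mono (hG h))

theorem map_unionSpan_le {G G' : ℕ → Submodule ℚ W} {T : W →ₗ[K] W}
    (hT : ∀ d, ∀ x ∈ G d, T x ∈ G' d) : (unionSpan G).map T ≤ unionSpan G' := by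
  rw [unionSpan, Submodule.map_iSup]
  exact iSup_mono fun d => map_span_le_span (hT d)

theorem unionSpan_le_map_one_sub_X_smul {G : ℕ → Submodule ℚ W} (hG : ∀ d, (G d).FG)
    {T : W →ₗ[K] W} (hT : ∀ d, ∀ x ∈ G d, T x ∈ G d) :
    unionSpan G ≤ (unionSpan G).map (1 - (RatFunc.X : K) • T) := by
  rw [unionSpan, Submodule.map_iSup]
  exact iSup_mono fun d => span_le_map_one_sub_X_smul (hG d) (hT d)

/-- Each stage has finite dimension over $K$, so surjectivity there already forces injectivity. -/
theorem one_sub_X_smul_injOn {G : ℕ → Submodule ℚ W} (hmono : Monotone G) (hG : ∀ d, (G d).FG)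
    {T : W →ₗ[K] W} (hT : ∀ d, ∀ x ∈ G d, T x ∈ G d) {x : W} (hx : x ∈ unionSpan G)
    (h0 : (1 - (RatFunc.X : K) • T) x = 0) : x = 0 := by
  obtain ⟨d, hd⟩ := (mem_unionSpan hmono).1 hx
  set F := Submodule.span K (G d : Set W)
  have hmaps : ∀ y ∈ F, (1 - (RatFunc.X : K) • T) y ∈ F := fun y hy =>
    Submodule.sub_mem _ hy (Submodule.smul_mem _ _
      (map_span_le_span (hT d) (Submodule.mem_map_of_mem hy)))
  have : Module.Finite K F := Module.Finite.iff_fg.2 (span_finite_of_fg (hG d))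
  have hsurj : Function.Surjective ((1 - (RatFunc.X : K) • T).restrict hmaps) := by
    rintro ⟨y, hy⟩
    obtain ⟨z, hz, hzy⟩ := span_le_map_one_sub_X_smul (hG d) (hT d) hy
    exact ⟨⟨z, hz⟩, Subtype.ext hzy⟩
  have hinj := LinearMap.injective_iff_surjective.2 hsurj
  have := @hinj ⟨x, hd⟩ 0 (by ext; simpa using h0)
  simpa using congrArg Subtype.val this

end Perturbation

/-- A contraction up to a projection onto the top degree kills the cohomology below. -/
theorem exists_of_contraction {W : Type*} [AddCommGroup W] [Module K W]
    {d h p Φ : Module.End K W} {F : ℕ → Submodule K W} {m : ℕ}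
    (hΦ : d * h + h * d + p = Φ) (hdd : d * d = 0)
    (hd : ∀ k, (F k).map d ≤ F (k + 1)) (hh : ∀ k, (F (k + 1)).map h ≤ F k)
    (hh0 : ∀ x ∈ F 0, h x = 0) (hp : ∀ k < m, ∀ x ∈ F k, p x = 0)
    (hsurj : ∀ k, F k ≤ (F k).map Φ) (hinj : ∀ k, ∀ x ∈ F k, Φ x = 0 → x = 0)
    {k : ℕ} (hk : k < m) {x : W} (hx : x ∈ F k) (hhx : h (d x) = 0) :
    (k = 0 ∧ x = 0) ∨ ∃ j, k = j + 1 ∧ ∃ y ∈ F j, d y = x := by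
  have hΦa : ∀ y, Φ y = d (h y) + h (d y) + p y := fun y => by rw [← hΦ]; rfl
  have hdda : ∀ y, d (d y) = 0 := fun y => LinearMap.congr_fun hdd y
  have hΦx : Φ x = d (h x) := by rw [hΦa, hhx, hp k hk x hx]; simp
  cases k with
  | zero =>
    refine Or.inl ⟨rfl, hinj 0 x hx ?_⟩
    rw [hΦx, hh0 x hx, map_zero]
  | succ j =>
    refine Or.inr ⟨j, rfl, ?_⟩
    -- Choose $\Phi y=hx$. Then $\Phi(dy)=d\Phi y=dhx=\Phi x$, and injectivity of $\Phi$ gives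
    -- $dy=x$.
    obtain ⟨y, hy, hyx⟩ := hsurj j (hh j (Submodule.mem_map_of_mem hx))
    refine ⟨y, hy, ?_⟩
    have hdy : d y ∈ F (j + 1) := hd j (Submodule.mem_map_of_mem hy)
    have h1 : Φ (d y) = d (Φ y) := by
      rw [hΦa, hΦa, hdda, hp _ hk _ hdy, hp j (by omega) y hy]
      simp [hdda]
    have h2 := hinj (j + 1) (d y - x) (Submodule.sub_mem _ hdy hx)
      (by rw [map_sub, h1, hyx, hΦx, sub_self])
    exact sub_eq_zero.1 h2

/-! ### Exterior multiplication and contraction on families indexed by subsets -/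

section Exterior

variable {m : ℕ} {L : Type*} [AddCommGroup L] [Module K L]

/-- The sign of `e_i ∧ e_J` for `i ∉ J`. -/
def wedgeSign (i : Fin m) (J : Finset (Fin m)) : K := (-1 : K) ^ (J.filter (· < i)).card

theorem wedgeSign_mul_self (i : Fin m) (J : Finset (Fin m)) :
    wedgeSign i J * wedgeSign i J = 1 := by
  rw [wedgeSign, ← pow_add, Even.neg_one_pow ⟨_, rfl⟩]

theorem wedgeSign_insert {i j : Fin m} {J : Finset (Fin m)} (hj : j ∉ J) :
    wedgeSign i (insert j J) = (if j < i then -1 else 1) * wedgeSign i J := by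
  unfold wedgeSign
  rw [Finset.filter_insert]
  split_ifs with h
  · rw [Finset.card_insert_of_notMem (by simp [hj]), pow_succ]; ring
  · ring

theorem wedgeSign_erase {i j : Fin m} {J : Finset (Fin m)} (hj : j ∈ J) :
    wedgeSign i (J.erase j) = (if j < i then -1 else 1) * wedgeSign i J := by
  conv_rhs => rw [← Finset.insert_erase hj, wedgeSign_insert (Finset.notMem_erase j J)]
  split_ifs <;> ring

/-- Exterior multiplication by `e_i`. -/
def wedge (i : Fin m) : Module.End K (Finset (Fin m) → L) :=
  LinearMap.pi fun J => if i ∈ J then wedgeSign i J • LinearMap.proj (J.erase i) else 0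

/-- Contraction with the dual of `e_i`. -/
def contr (i : Fin m) : Module.End K (Finset (Fin m) → L) :=
  LinearMap.pi fun J => if i ∈ J then 0 else wedgeSign i J • LinearMap.proj (insert i J)

/-- A linear map acting on all components. -/
def lift (φ : Module.End K L) : Module.End K (Finset (Fin m) → L) :=
  LinearMap.pi fun J => φ ∘ₗ LinearMap.proj J

theorem wedge_apply (i : Fin m) (x : Finset (Fin m) → L) (J : Finset (Fin m)) :
    wedge i x J = if i ∈ J then wedgeSign i J • x (J.erase i) else 0 := by
  unfold wedge; rw [LinearMap.pi_apply]; split_ifs <;> rfl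

theorem contr_apply (i : Fin m) (x : Finset (Fin m) → L) (J : Finset (Fin m)) :
    contr i x J = if i ∈ J then 0 else wedgeSign i J • x (insert i J) := by
  unfold contr; rw [LinearMap.pi_apply]; split_ifs <;> rfl

@[simp]
theorem lift_apply (φ : Module.End K L) (x : Finset (Fin m) → L) (J : Finset (Fin m)) :
    lift φ x J = φ (x J) := rfl

theorem lift_mul (φ ψ : Module.End K L) :
    (lift (φ * ψ) : Module.End K (Finset (Fin m) → L)) = lift φ * lift ψ := rfl

theorem lift_one : (lift 1 : Module.End K (Finset (Fin m) → L)) = 1 := rfl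

theorem lift_sub (φ ψ : Module.End K L) :
    (lift (φ - ψ) : Module.End K (Finset (Fin m) → L)) = lift φ - lift ψ := rfl

theorem lift_mul_wedge (φ : Module.End K L) (i : Fin m) :
    lift φ * wedge i = wedge i * lift φ := by
  refine LinearMap.ext fun x => funext fun J => ?_
  simp only [Module.End.mul_apply, lift_apply, wedge_apply]
  split_ifs <;> simp

theorem lift_mul_contr (φ : Module.End K L) (i : Fin m) :
    lift φ * contr i = contr i * lift φ := by
  refine LinearMap.ext fun x => funext fun J => ?_
  simp only [Module.End.mul_apply, lift_apply, contr_apply]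
  split_ifs <;> simp

theorem wedge_mul_contr_apply (i : Fin m) (x : Finset (Fin m) → L) (J : Finset (Fin m)) :
    wedge i (contr i x) J = if i ∈ J then x J else 0 := by
  rw [wedge_apply]
  split_ifs with h
  · rw [contr_apply, if_neg (Finset.notMem_erase i J), Finset.insert_erase h, smul_smul,
      wedgeSign_erase h]
    simp [wedgeSign_mul_self]
  · rfl

theorem wedge_contr_add_self (i : Fin m) :
    wedge i * contr i + contr i * wedge i = (1 : Module.End K (Finset (Fin m) → L)) := by
  refine LinearMap.ext fun x => funext fun J => ?_
  simp only [LinearMap.add_apply, Pi.add_apply, Module.End.mul_apply, wedge_mul_contr_apply,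
    Module.End.one_apply]
  rw [contr_apply]
  split_ifs with h
  · simp
  · rw [wedge_apply, if_pos (Finset.mem_insert_self i J), smul_smul, wedgeSign_insert h,
      Finset.erase_insert h]
    simp [wedgeSign_mul_self]

/-- Both products reach the same component. Of the two signs affected by removing $i$ or inserting
$j$, exactly one flips, according to which index is smaller. -/
theorem wedge_contr_add {i j : Fin m} (hij : i ≠ j) :
    wedge i * contr j + contr j * wedge i = (0 : Module.End K (Finset (Fin m) → L)) := by
  refine LinearMap.ext fun x => funext fun J => ?_
  simp only [LinearMap.add_apply, Pi.add_apply, Module.End.mul_apply, wedge_apply, contr_apply,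
    LinearMap.zero_apply, Pi.zero_apply]
  by_cases hi : i ∈ J <;> by_cases hj : j ∈ J
  · simp [hi, hj, hij.symm]
  · have h1 : j ∉ J.erase i := fun h => hj (Finset.mem_of_mem_erase h)
    simp only [hi, hj, h1, if_true, if_false, Finset.mem_insert_of_mem hi, smul_smul,
      Finset.erase_insert_of_ne hij.symm]
    rw [← add_smul, wedgeSign_erase hi, wedgeSign_insert hj]
    rcases lt_or_gt_of_ne hij with h | h
    · simp only [h, not_lt_of_gt h, if_true, if_false]
      ring_nf; simp
    · simp only [h, not_lt_of_gt h, if_true, if_false]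
      ring_nf; simp
  · simp [hi, hj]
  · simp [hi, hj, hij]

theorem wedge_wedge_add (i j : Fin m) :
    wedge i * wedge j + wedge j * wedge i = (0 : Module.End K (Finset (Fin m) → L)) := by
  refine LinearMap.ext fun x => funext fun J => ?_
  simp only [LinearMap.add_apply, Pi.add_apply, Module.End.mul_apply, wedge_apply,
    LinearMap.zero_apply, Pi.zero_apply]
  by_cases hij : i = j
  · subst hij; simp
  by_cases hi : i ∈ J <;> by_cases hj : j ∈ J
  · have h1 : j ∈ J.erase i := Finset.mem_erase.2 ⟨Ne.symm hij, hj⟩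
    have h2 : i ∈ J.erase j := Finset.mem_erase.2 ⟨hij, hi⟩
    simp only [hi, hj, h1, h2, if_true, smul_smul]
    rw [Finset.erase_right_comm, ← add_smul, wedgeSign_erase hi, wedgeSign_erase hj]
    rcases lt_or_gt_of_ne hij with h | h
    · simp only [h, not_lt_of_gt h, if_true, if_false]
      ring_nf; simp
    · simp only [h, not_lt_of_gt h, if_true, if_false]
      ring_nf; simp
  all_goals simp [hi, hj]

theorem koszulD_eq_sum (φ : Fin m → L →ₗ[K] L) :
    koszulD φ = ∑ i, wedge i * lift (φ i) := by
  refine LinearMap.ext fun x => funext fun J => ?_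
  simp only [koszulD, LinearMap.pi_apply, LinearMap.sum_apply, Finset.sum_apply,
    Module.End.mul_apply, wedge_apply, lift_apply, LinearMap.smul_apply, LinearMap.comp_apply,
    LinearMap.proj_apply]
  rw [Finset.sum_ite_mem, Finset.univ_inter]
  rfl

theorem koszulD_apply (φ : Fin m → L →ₗ[K] L) (x : Finset (Fin m) → L) (J : Finset (Fin m)) :
    koszulD φ x J = ∑ j ∈ J, wedgeSign j J • φ j (x (J.erase j)) := by
  simp [koszulD, wedgeSign]

/-- The square is a double sum antisymmetric in $(i,j)$: wedges anticommute while the $\varphi_i$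
commute. It equals its own negative, and $2$ is invertible in $K$. -/
theorem koszulD_mul_self {φ : Fin m → Module.End K L} (hφ : ∀ i j, φ i * φ j = φ j * φ i) :
    (koszulD φ * koszulD φ : Module.End K (Finset (Fin m) → L)) = 0 := by
  set S := (koszulD φ * koszulD φ : Module.End K (Finset (Fin m) → L)) with hS
  have e : ∀ i j, (wedge i * lift (φ i)) * (wedge j * lift (φ j)) =
      (wedge i * wedge j) * lift (φ i * φ j) := fun i j => by
    rw [mul_assoc, ← mul_assoc (lift (φ i)), lift_mul_wedge, lift_mul]
    simp only [mul_assoc]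
  have h1 : S = ∑ i, ∑ j, (wedge i * wedge j) * lift (φ i * φ j) := by
    rw [hS, koszulD_eq_sum, Finset.sum_mul_sum]
    simp only [e]
  have h2 : S = -S := by
    conv_rhs => rw [h1, Finset.sum_comm]
    rw [h1, ← Finset.sum_neg_distrib]
    refine Finset.sum_congr rfl fun i _ => ?_
    rw [← Finset.sum_neg_distrib]
    refine Finset.sum_congr rfl fun j _ => ?_
    rw [hφ i j, eq_neg_iff_add_eq_zero, ← add_mul, wedge_wedge_add, zero_mul]
  have h3 : (2 : K) • S = 0 := by
    rw [two_smul]; nth_rewrite 2 [h2]; exact add_neg_cancel S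
  exact (smul_eq_zero.1 h3).resolve_left two_ne_zero

/-- The anticommutator of a Koszul differential with a contraction by an operator that inverts
one of the maps on the left and commutes with the others. -/
theorem koszulD_anticomm {φ : Fin m → Module.End K L} {j : Fin m} {h : Module.End K L}
    (hj : h * φ j = 1) (hc : ∀ i, i ≠ j → h * φ i = φ i * h) :
    koszulD φ * (contr j * lift h) + (contr j * lift h) * koszulD φ =
      1 - wedge j * contr j * lift (1 - φ j * h) := by
  have e1 : ∀ i, (wedge i * lift (φ i)) * (contr j * lift h) =
      (wedge i * contr j) * lift (φ i * h) := fun i => by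
    rw [mul_assoc, ← mul_assoc (lift (φ i)), lift_mul_contr, lift_mul]
    simp only [mul_assoc]
  have e2 : ∀ i, (contr j * lift h) * (wedge i * lift (φ i)) =
      (contr j * wedge i) * lift (h * φ i) := fun i => by
    rw [mul_assoc, ← mul_assoc (lift h), lift_mul_wedge, lift_mul]
    simp only [mul_assoc]
  rw [koszulD_eq_sum, Finset.sum_mul, Finset.mul_sum, ← Finset.sum_add_distrib,
    Finset.sum_eq_single j]
  · rw [e1, e2, hj, lift_one, lift_sub, lift_one, mul_sub, mul_one, mul_one,
      ← wedge_contr_add_self j]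
    abel
  · intro i _ hi
    rw [e1, e2, hc i hi, ← add_mul, wedge_contr_add hi, zero_mul]
  · simp

end Exterior

/-! ### Composing homotopies -/

section Compose

variable {A : Type*} [Ring A]

/-- The product of the operators `1 - [d, h]`, for `h` in a list of homotopies. -/
def projProd (d : A) : List A → A
  | [] => 1
  | h :: t => (1 - (d * h + h * d)) * projProd d t

/-- The homotopy between `1` and `projProd`. -/
def homotopySum (d : A) : List A → A
  | [] => 0
  | h :: t => h + (1 - (d * h + h * d)) * homotopySum d t

/-- Each factor $1-[d,h]$, with $[d,h]=dh+hd$, commutes with $d$ because $d^2=0$, so homotopies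
compose as for chain maps. -/
theorem homotopySum_anticomm {d : A} (hd : d * d = 0) (l : List A) :
    d * homotopySum d l + homotopySum d l * d = 1 - projProd d l := by
  induction l with
  | nil => simp [homotopySum, projProd]
  | cons h t ih =>
    have hdd : ∀ x, d * (d * x) = 0 := fun x => by rw [← mul_assoc, hd, zero_mul]
    have hcomm : d * (1 - (d * h + h * d)) = (1 - (d * h + h * d)) * d := by
      simp only [mul_sub, mul_add, sub_mul, add_mul, mul_assoc, hdd, hd]
      simp
    have h2 : projProd d t = 1 - (d * homotopySum d t + homotopySum d t * d) := by
      rw [ih]; abel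
    rw [projProd, h2, homotopySum, mul_add, add_mul, ← mul_assoc d, hcomm]
    noncomm_ring

end Compose

/-- The standard instances, put before the ones of `RatFunc` for the tactic `module`. -/
local instance : Algebra ℕ K := Semiring.toNatAlgebra

local instance : Algebra ℤ K := Ring.toIntAlgebra K

/-! ### Coordinates and the operators on monomials -/

theorem mono_mul_mono {n : ℕ} (u v : Fin n → ℤ) : mono u * mono v = mono (v + u) := by
  simp [mono, AddMonoidAlgebra.single_mul_single, add_comm]

theorem laurent_hom_ext {n : ℕ} {φ ψ : Module.End K (Laurent n)}
    (h : ∀ u, φ (mono u) = ψ (mono u)) : φ = ψ :=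
  (AddMonoidAlgebra.basis (Fin n → ℤ) K).ext fun u => by simpa [mono] using h u

theorem linearIndependent_mono {n : ℕ} : LinearIndependent K (mono (n := n)) := by
  have := (AddMonoidAlgebra.basis (Fin n → ℤ) K).linearIndependent
  convert this using 1
  ext u
  simp [mono]

/-- The coordinates of a vector with respect to `a₁, …, a_m`, computed with a left inverse of the
matrix of columns `a_j`. -/
def coord {m n : ℕ} (β : Matrix (Fin m) (Fin n) ℚ) (u : Fin n → ℤ) (j : Fin m) : ℚ :=
  ∑ i, β j i * (u i : ℚ)

theorem coord_add {m n : ℕ} (β : Matrix (Fin m) (Fin n) ℚ) (u v : Fin n → ℤ) (j : Fin m) :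
    coord β (u + v) j = coord β u j + coord β v j := by
  simp [coord, mul_add, Finset.sum_add_distrib]

theorem coord_sub {m n : ℕ} (β : Matrix (Fin m) (Fin n) ℚ) (u v : Fin n → ℤ) (j : Fin m) :
    coord β (u - v) j = coord β u j - coord β v j := by
  simp [coord, mul_sub, Finset.sum_sub_distrib]

theorem coord_nsmul {m n : ℕ} (β : Matrix (Fin m) (Fin n) ℚ) (k : ℕ) (u : Fin n → ℤ)
    (j : Fin m) : coord β (k • u) j = k * coord β u j := by
  simp only [coord, Pi.smul_apply, Finset.mul_sum]
  refine Finset.sum_congr rfl fun i _ => ?_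
  push_cast [nsmul_eq_mul]
  ring

namespace Data

variable {m n : ℕ} (P : Data m n)

theorem coord_a {β : Matrix (Fin m) (Fin n) ℚ} (hβ : β * P.alpha = 1) (k j : Fin m) :
    coord β (P.a k) j = if j = k then 1 else 0 := by
  have := congrFun (congrFun hβ j) k
  rw [Matrix.mul_apply, Matrix.one_apply] at this
  simpa [coord, alpha] using this

theorem coord_a₀ {β : Matrix (Fin m) (Fin n) ℚ} (hβ : β * P.alpha = 1) (j : Fin m) :
    coord β P.a₀ j = P.l j / P.l₀ := by
  have h0 : (P.l₀ : ℚ) ≠ 0 := by exact_mod_cast P.l₀_pos.ne'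
  have h1 : coord β (P.l₀ • P.a₀) j = P.l j := by
    rw [P.relation]
    have : coord β (∑ k, P.l k • P.a k) j = ∑ k, coord β (P.l k • P.a k) j := by
      simp only [coord, Finset.sum_apply]
      rw [Finset.sum_comm]
      push_cast
      simp only [Finset.mul_sum]
    rw [this]
    simp only [coord_nsmul, P.coord_a hβ]
    simp
  rw [coord_nsmul] at h1
  rw [eq_div_iff h0, mul_comm]
  exact h1

theorem D_mono (i : Fin n) (u : Fin n → ℤ) :
    P.D i (mono u) = ((u i : ℤ) : K) • mono u +
      ∑ k, ((P.l k : K) * ((P.a k i : ℤ) : K)) • mono (u + P.a k) -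
      ((P.l₀ : K) * RatFunc.X * ((P.a₀ i : ℤ) : K)) • mono (u + P.a₀) := by
  rw [D, LinearMap.add_apply, euler_mono, LinearMap.mulLeft_apply, f, map_sub, map_sum]
  simp only [map_smul, euler_mono, sub_mul, Finset.sum_mul, smul_mul_assoc, mono_mul_mono,
    smul_smul]
  rw [add_sub_assoc]

/-- Left multiplication by $\beta$ turns exponents into coordinates. The $j$-th coordinate of
$\mathbf a_0$ is $\ell_j/\ell_0$, which cancels the factor $\ell_0$ in $f_\lambda$. -/
theorem Dtilde_mono {β : Matrix (Fin m) (Fin n) ℚ} (hβ : β * P.alpha = 1) (j : Fin m)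
    (u : Fin n → ℤ) :
    P.Dtilde β j (mono u) = (coord β u j : K) • mono u + (P.l j : K) • mono (u + P.a j) -
      (RatFunc.X * (P.l j : K)) • mono (u + P.a₀) := by
  have hc : ∀ v : Fin n → ℤ, ∑ i, ((β j i : ℚ) : K) * ((v i : ℤ) : K) = (coord β v j : K) :=
    fun v => by simp [coord]
  have h0 : (P.l₀ : K) ≠ 0 := by exact_mod_cast P.l₀_pos.ne'
  rw [Dtilde, LinearMap.sum_apply]
  simp only [LinearMap.smul_apply, D_mono, smul_add, smul_sub, Finset.sum_add_distrib,
    Finset.sum_sub_distrib, smul_smul, Finset.smul_sum]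
  rw [Finset.sum_comm]
  simp only [← Finset.sum_smul]
  congr 1
  · rw [hc]
    congr 1
    have : ∀ k, ∑ i, ((β j i : ℚ) : K) * ((P.l k : K) * ((P.a k i : ℤ) : K)) =
        if j = k then (P.l k : K) else 0 := fun k => by
      simp only [mul_left_comm _ (P.l k : K)]
      rw [← Finset.mul_sum, hc, P.coord_a hβ]
      split_ifs <;> simp
    simp [this]
  · congr 1
    simp only [mul_left_comm _ ((P.l₀ : K) * RatFunc.X)]
    rw [← Finset.mul_sum, hc, P.coord_a₀ hβ]
    push_cast
    field_simp

/-- Multiplication by `ℓ_j x^{a₀}`. -/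
def pert (j : Fin m) : Module.End K (Laurent n) := (P.l j : K) • LinearMap.mulLeft K (mono P.a₀)

theorem pert_mono (j : Fin m) (u : Fin n → ℤ) :
    P.pert j (mono u) = (P.l j : K) • mono (u + P.a₀) := by
  simp [pert, mono_mul_mono]

/-- The operator `D̃_j` at `λ = 0`. -/
def Dzero (β : Matrix (Fin m) (Fin n) ℚ) (j : Fin m) : Module.End K (Laurent n) :=
  P.Dtilde β j + (RatFunc.X : K) • P.pert j

section

variable {β : Matrix (Fin m) (Fin n) ℚ} (hβ : β * P.alpha = 1)
include hβ

theorem Dzero_mono (j : Fin m) (u : Fin n → ℤ) :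
    P.Dzero β j (mono u) = (coord β u j : K) • mono u + (P.l j : K) • mono (u + P.a j) := by
  rw [Dzero, LinearMap.add_apply, P.Dtilde_mono hβ, LinearMap.smul_apply, pert_mono, smul_smul]
  abel

theorem Dzero_comm (i j : Fin m) :
    P.Dzero β i * P.Dzero β j = P.Dzero β j * P.Dzero β i := by
  by_cases hij : i = j
  · rw [hij]
  refine laurent_hom_ext fun u => ?_
  simp only [Module.End.mul_apply, P.Dzero_mono hβ, map_add, map_smul, coord_add,
    P.coord_a hβ, if_neg hij, if_neg (Ne.symm hij), add_zero, add_right_comm u (P.a j) (P.a i)]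
  module

/-- Shifting by $\mathbf a_0$ changes every coordinate, but the resulting correction
$\lambda\ell_i\ell_j/\ell_0$ is symmetric in $i$ and $j$. -/
theorem Dtilde_comm (i j : Fin m) :
    (P.Dtilde β i : Module.End K (Laurent n)) * P.Dtilde β j = P.Dtilde β j * P.Dtilde β i := by
  by_cases hij : i = j
  · rw [hij]
  refine laurent_hom_ext fun u => ?_
  simp only [Module.End.mul_apply, P.Dtilde_mono hβ, map_add, map_sub, map_smul, coord_add,
    P.coord_a hβ, P.coord_a₀ hβ, if_neg hij, if_neg (Ne.symm hij), add_zero,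
    add_right_comm u (P.a j) (P.a i), add_right_comm u P.a₀ (P.a i),
    add_right_comm u P.a₀ (P.a j)]
  push_cast
  module

end

/-! ### Inverting the operators at `λ = 0` -/

/-- The value on `x^u` of the left inverse of `Dzero`, if `⌊c_j⌋ = k`. -/
def invPos (β : Matrix (Fin m) (Fin n) ℚ) (j : Fin m) : ℕ → (Fin n → ℤ) → Laurent n
  | 0, _ => 0
  | k + 1, u => (P.l j : K)⁻¹ •
      (mono (u - P.a j) - (coord β (u - P.a j) j : K) • invPos β j k (u - P.a j))

/-- The value on `x^u` of the left inverse of `Dzero`, if `⌊c_j⌋ = -k`. -/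
def invNeg (β : Matrix (Fin m) (Fin n) ℚ) (j : Fin m) : ℕ → (Fin n → ℤ) → Laurent n
  | 0, _ => 0
  | k + 1, u => (coord β u j : K)⁻¹ • (mono u - (P.l j : K) • invNeg β j k (u + P.a j))

/-- The value on `x^u` of the left inverse of `Dzero`, if `⌊c_j⌋ = z`. -/
def invInt (β : Matrix (Fin m) (Fin n) ℚ) (j : Fin m) (z : ℤ) (u : Fin n → ℤ) : Laurent n :=
  match z with
  | Int.ofNat k => P.invPos β j k u
  | Int.negSucc k => P.invNeg β j (k + 1) u

/-- A left inverse of `Dzero` which commutes with the other operators. -/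
def Dinv (β : Matrix (Fin m) (Fin n) ℚ) (j : Fin m) : Module.End K (Laurent n) :=
  (AddMonoidAlgebra.basis (Fin n → ℤ) K).constr K fun u => P.invInt β j ⌊coord β u j⌋ u

theorem Dinv_mono (β : Matrix (Fin m) (Fin n) ℚ) (j : Fin m) (u : Fin n → ℤ) :
    P.Dinv β j (mono u) = P.invInt β j ⌊coord β u j⌋ u := by
  have := (AddMonoidAlgebra.basis (Fin n → ℤ) K).constr_basis K
    (fun u => P.invInt β j ⌊coord β u j⌋ u) u
  simpa [Dinv, mono] using this

theorem Dinv_mono_of_lt (β : Matrix (Fin m) (Fin n) ℚ) {j : Fin m} {u : Fin n → ℤ}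
    (h0 : 0 ≤ coord β u j) (h1 : coord β u j < 1) : P.Dinv β j (mono u) = 0 := by
  rw [Dinv_mono, Int.floor_eq_zero_iff.2 ⟨h0, h1⟩]
  rfl

section

variable {β : Matrix (Fin m) (Fin n) ℚ} (hβ : β * P.alpha = 1)
include hβ

/-- This recursion is exactly the condition that `Dinv` be a left inverse of `Dzero`. Starting from
$0$ on $0\le c_j<1$, it is solved upwards by dividing by $\ell_j$ and downwards by dividing by
$c_j$, which is negative there. -/
theorem Dinv_mono_add (j : Fin m) (u : Fin n → ℤ) :
    P.Dinv β j (mono (u + P.a j)) =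
      (P.l j : K)⁻¹ • (mono u - (coord β u j : K) • P.Dinv β j (mono u)) := by
  have hl : (P.l j : K) ≠ 0 := by exact_mod_cast (P.l_pos j).ne'
  rw [Dinv_mono, Dinv_mono, coord_add, P.coord_a hβ, if_pos rfl, Int.floor_add_one]
  rcases hz : ⌊coord β u j⌋ with k | k
  · change P.invPos β j (k + 1) (u + P.a j) = _
    rw [invPos]
    simp only [add_sub_cancel_right]
    rfl
  · have hc : (coord β u j : K) ≠ 0 := by
      have : coord β u j < 0 := by
        rw [← Int.floor_lt_zero, hz]; exact Int.negSucc_lt_zero k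
      exact_mod_cast this.ne
    -- For $k=0$ the shift passes from floor $-1$ to floor $0$, where both recursive families are
    -- zero.
    have h2 : P.invInt β j (Int.negSucc k + 1) (u + P.a j) = P.invNeg β j k (u + P.a j) := by
      cases k <;> rfl
    rw [h2]
    change _ = (P.l j : K)⁻¹ • (mono u - (coord β u j : K) • P.invNeg β j (k + 1) u)
    rw [invNeg, smul_smul, mul_inv_cancel₀ hc, one_smul, sub_sub_cancel, smul_smul,
      inv_mul_cancel₀ hl, one_smul]

theorem Dinv_mul_Dzero (j : Fin m) : P.Dinv β j * P.Dzero β j = 1 := by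
  have hl : (P.l j : K) ≠ 0 := by exact_mod_cast (P.l_pos j).ne'
  refine laurent_hom_ext fun u => ?_
  rw [Module.End.mul_apply, P.Dzero_mono hβ, map_add, map_smul, map_smul, P.Dinv_mono_add hβ,
    smul_smul, mul_inv_cancel₀ hl]
  simp

/-- For $i\ne j$, a shift by $\mathbf a_j$ leaves $c_i$ unchanged and a shift by $\mathbf a_i$
leaves $c_j$ unchanged, so the recursion passes through `Dzero` in direction $i$. -/
theorem Dzero_invPos {i j : Fin m} (hij : i ≠ j) (k : ℕ) (u : Fin n → ℤ) :
    P.Dzero β i (P.invPos β j k u) = (coord β u i : K) • P.invPos β j k u +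
      (P.l i : K) • P.invPos β j k (u + P.a i) := by
  induction k generalizing u with
  | zero => simp [invPos]
  | succ k ih =>
    have e : u + P.a i - P.a j = u - P.a j + P.a i := by abel
    simp only [invPos, e, map_smul, map_sub, P.Dzero_mono hβ, ih, coord_add, coord_sub,
      P.coord_a hβ, if_neg hij, if_neg hij.symm, if_true, sub_zero, add_zero]
    module

theorem Dzero_invNeg {i j : Fin m} (hij : i ≠ j) (k : ℕ) (u : Fin n → ℤ) :
    P.Dzero β i (P.invNeg β j k u) = (coord β u i : K) • P.invNeg β j k u +
      (P.l i : K) • P.invNeg β j k (u + P.a i) := by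
  induction k generalizing u with
  | zero => simp [invNeg]
  | succ k ih =>
    simp only [invNeg, map_smul, map_sub, P.Dzero_mono hβ, ih, coord_add,
      P.coord_a hβ, if_neg hij, if_neg hij.symm, add_zero, add_right_comm u (P.a i) (P.a j)]
    module

theorem Dinv_mul_Dzero_of_ne {i j : Fin m} (hij : i ≠ j) :
    P.Dinv β j * P.Dzero β i = P.Dzero β i * P.Dinv β j := by
  refine laurent_hom_ext fun u => ?_
  simp only [Module.End.mul_apply, P.Dzero_mono hβ, map_add, map_smul, Dinv_mono, coord_add,
    P.coord_a hβ, if_neg hij.symm, add_zero]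
  rcases ⌊coord β u j⌋ with k | k
  · exact (P.Dzero_invPos hβ hij k u).symm
  · exact (P.Dzero_invNeg hβ hij (k + 1) u).symm

/-- The projection with kernel the image of `Dzero`, on a monomial. -/
theorem exists_one_sub_Dzero_mul_Dinv_mono (j : Fin m) (k : ℕ) (u : Fin n → ℤ)
    (hk : ⌊coord β u j⌋ = k) :
    ∃ r : K, (1 - P.Dzero β j * P.Dinv β j) (mono u) = r • mono (u - k • P.a j) ∧
      (coord β (u - k • P.a j) j = 0 → 0 < coord β u j → r = 0) := by
  induction k generalizing u with
  | zero =>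
    obtain ⟨h0, h1⟩ := Int.floor_eq_zero_iff.1 (by simpa using hk)
    refine ⟨1, ?_, fun h2 h3 => ?_⟩
    · simp [P.Dinv_mono_of_lt β h0 h1]
    · rw [zero_smul, sub_zero] at h2
      exact absurd h2 h3.ne'
  | succ k ih =>
    set v := u - P.a j with hv
    have huv : u = v + P.a j := by rw [hv]; abel
    have hcv : coord β u j = coord β v j + 1 := by
      rw [huv, coord_add, P.coord_a hβ, if_pos rfl]
    have hkv : ⌊coord β v j⌋ = k := by
      rw [hcv, Int.floor_add_one] at hk; push_cast at hk; linarith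
    obtain ⟨r, hr, hr0⟩ := ih v hkv
    have e : u - (k + 1) • P.a j = v - k • P.a j := by rw [hv, succ_nsmul]; abel
    have hl : (P.l j : K) ≠ 0 := by exact_mod_cast (P.l_pos j).ne'
    -- Modulo the image of `Dzero`, $x^{v+\mathbf a_j}\equiv-\ell_j^{-1}c_j(v)x^v$. Descending from
    -- a positive integral coordinate to $0$ therefore picks up a factor $0$.
    refine ⟨-((P.l j : K)⁻¹ * (coord β v j : K)) * r, ?_, fun h2 _ => ?_⟩
    · rw [e, mul_smul, ← hr]
      simp only [LinearMap.sub_apply, Module.End.one_apply, Module.End.mul_apply]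
      rw [huv, P.Dinv_mono_add hβ, map_smul, map_sub, P.Dzero_mono hβ, map_smul]
      simp only [smul_sub, smul_add, smul_smul, inv_mul_cancel₀ hl, one_smul]
      module
    · rw [e] at h2
      have h3 : 0 ≤ coord β v j := Int.floor_nonneg.1 (by rw [hkv]; positivity)
      rcases h3.eq_or_lt with h4 | h4
      · rw [← h4]; simp
      · rw [hr0 h2 h4, mul_zero]

end

theorem invPos_mem (β : Matrix (Fin m) (Fin n) ℚ) (j : Fin m) (N : Submodule ℚ (Laurent n))
    (k : ℕ) (u : Fin n → ℤ) (h : ∀ i, 1 ≤ i → i ≤ k → mono (u - i • P.a j) ∈ N) :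
    P.invPos β j k u ∈ N := by
  induction k generalizing u with
  | zero => exact N.zero_mem
  | succ k ih =>
    have e : (P.l j : K)⁻¹ = (((P.l j : ℚ)⁻¹ : ℚ) : K) := by push_cast; rfl
    rw [invPos, e, ratCast_smul_eq, ratCast_smul_eq]
    refine N.smul_mem _ (N.sub_mem (by simpa using h 1 le_rfl (by omega))
      (N.smul_mem _ (ih _ fun i h1 h2 => ?_)))
    have := h (i + 1) (by omega) (by omega)
    rwa [succ_nsmul', ← sub_sub] at this

/-! ### The lattice points and the graded pieces -/

section Lattice

include P in
theorem m_pos : 0 < m := by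
  rcases Nat.eq_zero_or_pos m with h | h
  · subst h
    have := P.l₀_eq_sum
    simp only [Finset.univ_eq_empty, Finset.sum_empty] at this
    exact absurd this P.l₀_pos.ne'
  · exact h

theorem toReal_add (u v : Fin n → ℤ) : toReal (u + v) = toReal u + toReal v := by
  ext i; simp [toReal]

theorem toReal_sub (u v : Fin n → ℤ) : toReal (u - v) = toReal u - toReal v := by
  ext i; simp [toReal]

theorem toReal_nsmul (k : ℕ) (u : Fin n → ℤ) : toReal (k • u) = (k : ℝ) • toReal u := by
  ext i; simp [toReal]

theorem a_mem_VZ (j : Fin m) : P.a j ∈ P.VZ := Submodule.subset_span ⟨j, rfl⟩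

theorem add_mem_VZ {u v : Fin n → ℤ} (hu : u ∈ P.VZ) (hv : v ∈ P.VZ) : u + v ∈ P.VZ := by
  change toReal (u + v) ∈ P.V
  rw [toReal_add]
  exact P.V.add_mem hu hv

theorem sub_mem_VZ {u v : Fin n → ℤ} (hu : u ∈ P.VZ) (hv : v ∈ P.VZ) : u - v ∈ P.VZ := by
  change toReal (u - v) ∈ P.V
  rw [toReal_sub]
  exact P.V.sub_mem hu hv

theorem nsmul_mem_VZ (k : ℕ) {u : Fin n → ℤ} (hu : u ∈ P.VZ) : k • u ∈ P.VZ := by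
  change toReal (k • u) ∈ P.V
  rw [toReal_nsmul]
  exact P.V.smul_mem _ hu

theorem a₀_mem_VZ : P.a₀ ∈ P.VZ := by
  have h0 : (P.l₀ : ℝ) ≠ 0 := by exact_mod_cast P.l₀_pos.ne'
  have h1 : (P.l₀ : ℝ) • toReal P.a₀ = ∑ j, (P.l j : ℝ) • toReal (P.a j) := by
    rw [← toReal_nsmul, P.relation]
    ext i
    simp [toReal]
  have h2 : (P.l₀ : ℝ) • toReal P.a₀ ∈ P.V := by
    rw [h1]
    exact P.V.sum_mem fun j _ => P.V.smul_mem _ (P.a_mem_VZ j)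
  exact (P.V.smul_mem_iff h0).1 h2

variable {β : Matrix (Fin m) (Fin n) ℚ} (hβ : β * P.alpha = 1)
include hβ

theorem coord_eq_of_sum {u : Fin n → ℤ} {c : Fin m → ℝ}
    (h : toReal u = ∑ j, c j • toReal (P.a j)) (j : Fin m) : (coord β u j : ℝ) = c j := by
  have h1 : (coord β u j : ℝ) = ∑ i, (β j i : ℝ) * toReal u i := by
    simp [coord, toReal]
  rw [h1, h]
  simp only [Finset.sum_apply, Pi.smul_apply, smul_eq_mul, Finset.mul_sum]
  rw [Finset.sum_comm]
  have h2 : ∀ k, ∑ i, (β j i : ℝ) * (c k * toReal (P.a k) i) =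
      c k * (coord β (P.a k) j : ℝ) := fun k => by
    simp only [coord, toReal, Rat.cast_sum, Rat.cast_mul, Rat.cast_intCast, Finset.mul_sum]
    exact Finset.sum_congr rfl fun i _ => by ring
  simp only [h2, P.coord_a hβ]
  simp [apply_ite]

theorem toReal_eq_sum_coord {u : Fin n → ℤ} (hu : u ∈ P.VZ) :
    toReal u = ∑ j, (coord β u j : ℝ) • toReal (P.a j) := by
  obtain ⟨c, hc⟩ := (Submodule.mem_span_range_iff_exists_fun ℝ).1 hu
  have := P.coord_eq_of_sum hβ hc.symm
  rw [← hc]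
  exact Finset.sum_congr rfl fun j _ => by rw [this]

theorem apply_eq_sum_coord {u : Fin n → ℤ} (hu : u ∈ P.VZ) (i : Fin n) :
    (u i : ℚ) = ∑ j, coord β u j * (P.a j i : ℚ) := by
  have := congrFun (P.toReal_eq_sum_coord hβ hu) i
  simp only [toReal, Finset.sum_apply, Pi.smul_apply, smul_eq_mul] at this
  exact_mod_cast this

theorem finite_of_coord_bounded (b : ℚ) :
    {u | u ∈ P.VZ ∧ ∀ j, 0 ≤ coord β u j ∧ coord β u j ≤ b}.Finite := by
  set B : Fin n → ℤ := fun i => ⌈∑ j, b * |(P.a j i : ℚ)|⌉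
  refine (Set.finite_Icc (-B) B).subset ?_
  rintro u ⟨hu, h⟩
  have key : ∀ i, |u i| ≤ B i := fun i => by
    have : |(u i : ℚ)| ≤ ∑ j, b * |(P.a j i : ℚ)| := by
      rw [P.apply_eq_sum_coord hβ hu]
      refine (Finset.abs_sum_le_sum_abs _ _).trans (Finset.sum_le_sum fun j _ => ?_)
      rw [abs_mul, abs_of_nonneg (h j).1]
      exact mul_le_mul_of_nonneg_right (h j).2 (abs_nonneg _)
    have h2 : |(u i : ℚ)| ≤ (B i : ℚ) := this.trans (Int.le_ceil _)
    exact_mod_cast h2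
  exact ⟨fun i => (abs_le.1 (key i)).1, fun i => (abs_le.1 (key i)).2⟩

end Lattice

/-- The exponents of the monomials in the component of `e_J`, for the variant of the complex with
exponents in `Γ` and with positivity required at the indices in `Z`. -/
def expSet (β : Matrix (Fin m) (Fin n) ℚ) (Z : Finset (Fin m)) (Γ : Set (Fin n → ℤ))
    (J : Finset (Fin m)) : Set (Fin n → ℤ) :=
  {u | u ∈ P.VZ ∧ u ∈ Γ ∧ (∀ j, 0 ≤ coord β u j) ∧ ∀ j ∈ J, j ∈ Z → 0 < coord β u j}

/-- The exponents in `expSet` of bounded weight. -/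
def expSetLE (β : Matrix (Fin m) (Fin n) ℚ) (Z : Finset (Fin m)) (Γ : Set (Fin n → ℤ)) (d : ℕ)
    (J : Finset (Fin m)) : Set (Fin n → ℤ) :=
  {u | u ∈ P.expSet β Z Γ J ∧ ∑ j, coord β u j ≤ d + J.card}

/-- The exponents in `expSet` lying in the half-open parallelepiped. -/
def expBox (β : Matrix (Fin m) (Fin n) ℚ) (Z : Finset (Fin m)) (Γ : Set (Fin n → ℤ)) :
    Set (Fin n → ℤ) := {u | u ∈ P.expSet β Z Γ Finset.univ ∧ ∀ j, coord β u j < 1}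

/-- The rational span of the monomials with exponent in `expSetLE`. -/
def ratPiece (β : Matrix (Fin m) (Fin n) ℚ) (Z : Finset (Fin m)) (Γ : Set (Fin n → ℤ)) (d : ℕ)
    (J : Finset (Fin m)) : Submodule ℚ (Laurent n) :=
  Submodule.span ℚ (mono '' P.expSetLE β Z Γ d J)

/-- The cochains of degree `k` with components in `ratPiece`. -/
def ratCochains (β : Matrix (Fin m) (Fin n) ℚ) (Z : Finset (Fin m)) (Γ : Set (Fin n → ℤ))
    (k d : ℕ) : Submodule ℚ (Finset (Fin m) → Laurent n) :=
  Submodule.pi Set.univ fun J => if J.card = k then P.ratPiece β Z Γ d J else ⊥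

/-- The span of the monomials with exponent in `expSet`. -/
def piece (β : Matrix (Fin m) (Fin n) ℚ) (Z : Finset (Fin m)) (Γ : Set (Fin n → ℤ))
    (J : Finset (Fin m)) : Submodule K (Laurent n) :=
  Submodule.span K (mono '' P.expSet β Z Γ J)

/-- The cochains of degree `k` with components in `piece`. -/
def cochains (β : Matrix (Fin m) (Fin n) ℚ) (Z : Finset (Fin m)) (Γ : Set (Fin n → ℤ))
    (k : ℕ) : Submodule K (Finset (Fin m) → Laurent n) :=
  koszulCochains (P.piece β Z Γ) k

section Pieces

variable {β : Matrix (Fin m) (Fin n) ℚ} {Z : Finset (Fin m)} {Γ : Set (Fin n → ℤ)}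

theorem mem_ratCochains {k d : ℕ} {x : Finset (Fin m) → Laurent n} :
    x ∈ P.ratCochains β Z Γ k d ↔
      ∀ J, (J.card = k → x J ∈ P.ratPiece β Z Γ d J) ∧ (J.card ≠ k → x J = 0) := by
  simp only [ratCochains, Submodule.mem_pi, Set.mem_univ, true_imp_iff]
  refine forall_congr' fun J => ?_
  split_ifs with h <;> simp [h]

theorem mem_cochains {k : ℕ} {x : Finset (Fin m) → Laurent n} :
    x ∈ P.cochains β Z Γ k ↔
      ∀ J, (J.card = k → x J ∈ P.piece β Z Γ J) ∧ (J.card ≠ k → x J = 0) := by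
  simp only [cochains, koszulCochains, Submodule.mem_pi, Set.mem_univ, true_imp_iff]
  refine forall_congr' fun J => ?_
  split_ifs with h <;> simp [h]

theorem single_mem_cochains {J : Finset (Fin m)} {s : Laurent n} (hs : s ∈ P.piece β Z Γ J) :
    Pi.single J s ∈ P.cochains β Z Γ J.card := by
  refine P.mem_cochains.2 fun I => ⟨fun _ => ?_, fun hI => ?_⟩
  · by_cases h : I = J
    · subst h; simpa using hs
    · rw [Pi.single_eq_of_ne h]; exact Submodule.zero_mem _
  · exact Pi.single_eq_of_ne (fun h => hI (by rw [h])) _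

theorem eq_single_univ_of_mem {x : Finset (Fin m) → Laurent n} (hx : x ∈ P.cochains β Z Γ m) :
    x = Pi.single Finset.univ (x Finset.univ) := by
  ext1 J
  by_cases hJ : J = Finset.univ
  · subst hJ; simp
  · rw [Pi.single_eq_of_ne hJ]
    exact (P.mem_cochains.1 hx J).2 fun h =>
      hJ ((Finset.card_eq_iff_eq_univ J).1 (by simpa using h))

theorem ratCochains_mono (k : ℕ) : Monotone (P.ratCochains β Z Γ k) := by
  intro d e hde x hx
  rw [mem_ratCochains] at hx ⊢
  refine fun J => ⟨fun h => ?_, (hx J).2⟩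
  refine Submodule.span_mono (Set.image_mono ?_) ((hx J).1 h)
  rintro u ⟨hu, h2⟩
  refine ⟨hu, h2.trans ?_⟩
  gcongr

/-- This makes the cochains a union of stages with finitely generated rational forms, the setting in
which $1-\lambda T$ is invertible. -/
theorem cochains_eq_unionSpan (k : ℕ) :
    P.cochains β Z Γ k = unionSpan (P.ratCochains β Z Γ k) := by
  apply le_antisymm
  · rw [cochains, koszulCochains, ← Submodule.iSup_map_single]
    refine iSup_le fun J => ?_
    split_ifs with hJ
    · rw [piece, Submodule.map_span, Submodule.span_le]
      rintro _ ⟨_, ⟨u, hu, rfl⟩, rfl⟩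
      obtain ⟨d, hd⟩ := exists_nat_ge (∑ j, coord β u j)
      refine (mem_unionSpan (P.ratCochains_mono k)).2 ⟨d, Submodule.subset_span ?_⟩
      refine P.mem_ratCochains.2 fun I => ?_
      by_cases hI : I = J
      · subst hI
        refine ⟨fun _ => ?_, fun h => absurd hJ h⟩
        simp only [LinearMap.coe_single, Pi.single_eq_same]
        refine Submodule.subset_span ⟨u, ⟨hu, hd.trans ?_⟩, rfl⟩
        simp
      · simp [Pi.single_eq_of_ne hI]
    · simp
  · refine iSup_le fun d => Submodule.span_le.2 fun x hx => ?_
    have hx' := P.mem_ratCochains.1 hx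
    refine P.mem_cochains.2 fun J => ⟨fun h => ?_, (hx' J).2⟩
    have h1 := ratSpan_subset_span _ ((hx' J).1 h)
    exact Submodule.span_mono (Set.image_mono fun u hu => hu.1) h1

theorem ratCochains_fg (hβ : β * P.alpha = 1) (k d : ℕ) : (P.ratCochains β Z Γ k d).FG := by
  refine Submodule.fg_pi fun J => ?_
  split_ifs
  · refine Submodule.fg_span (Set.Finite.image _ ?_)
    refine (P.finite_of_coord_bounded hβ (d + J.card)).subset ?_
    rintro u ⟨⟨hu, _, h0, _⟩, hd⟩
    exact ⟨hu, fun j => ⟨h0 j, (Finset.single_le_sum (fun i _ => h0 i) (Finset.mem_univ j)).trans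
      hd⟩⟩
  · exact Submodule.fg_bot

theorem apply_mem_of_span {φ : Module.End K (Laurent n)} {X : Set (Fin n → ℤ)}
    {N : Submodule ℚ (Laurent n)} (h : ∀ u ∈ X, φ (mono u) ∈ N) {x : Laurent n}
    (hx : x ∈ Submodule.span ℚ (mono '' X)) : φ x ∈ N :=
  apply_mem_of_mem_ratSpan (by rintro _ ⟨u, hu, rfl⟩; exact h u hu) hx

theorem wedgeSign_smul_mem (N : Submodule ℚ (Laurent n)) (i : Fin m) (J : Finset (Fin m))
    {x : Laurent n} (hx : x ∈ N) : wedgeSign i J • x ∈ N := by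
  rcases neg_one_pow_eq_or K (J.filter (· < i)).card with h | h <;> rw [wedgeSign, h]
  · simpa using hx
  · simpa using hx

theorem koszulD_mem_ratCochains {φ : Fin m → Module.End K (Laurent n)} {d : ℕ}
    (h : ∀ J, ∀ i ∉ J, ∀ u ∈ P.expSetLE β Z Γ d J,
      φ i (mono u) ∈ P.ratPiece β Z Γ d (insert i J))
    {k : ℕ} {x : Finset (Fin m) → Laurent n} (hx : x ∈ P.ratCochains β Z Γ k d) :
    koszulD φ x ∈ P.ratCochains β Z Γ (k + 1) d := by
  rw [mem_ratCochains] at hx ⊢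
  intro J
  rw [koszulD_apply]
  refine ⟨fun hJ => Submodule.sum_mem _ fun j hj => wedgeSign_smul_mem _ _ _ ?_,
    fun hJ => Finset.sum_eq_zero fun j hj => ?_⟩
  · have := h (J.erase j) j (Finset.notMem_erase j J)
    rw [Finset.insert_erase hj] at this
    exact apply_mem_of_span this ((hx _).1 (by rw [Finset.card_erase_of_mem hj, hJ]; rfl))
  · rw [(hx (J.erase j)).2, map_zero, smul_zero]
    have := Finset.card_erase_add_one hj
    omega

theorem contr_mem_ratCochains {φ : Module.End K (Laurent n)} {d : ℕ} {j : Fin m}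
    (h : ∀ J, j ∉ J → ∀ u ∈ P.expSetLE β Z Γ d (insert j J),
      φ (mono u) ∈ P.ratPiece β Z Γ d J)
    {k : ℕ} {x : Finset (Fin m) → Laurent n} (hx : x ∈ P.ratCochains β Z Γ (k + 1) d) :
    (contr j * lift φ : Module.End K (Finset (Fin m) → Laurent n)) x ∈ P.ratCochains β Z Γ k d := by
  rw [mem_ratCochains] at hx ⊢
  intro J
  rw [Module.End.mul_apply, contr_apply]
  split_ifs with hj
  · exact ⟨fun _ => Submodule.zero_mem _, fun _ => rfl⟩
  · refine ⟨fun hJ => wedgeSign_smul_mem _ _ _ ?_, fun hJ => ?_⟩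
    · exact apply_mem_of_span (h J hj) ((hx _).1 (by rw [Finset.card_insert_of_notMem hj, hJ]))
    · rw [lift_apply, (hx (insert j J)).2, map_zero, smul_zero]
      rw [Finset.card_insert_of_notMem hj]
      omega

theorem contr_eq_zero_of_mem {φ : Module.End K (Laurent n)} {d : ℕ} (j : Fin m)
    {x : Finset (Fin m) → Laurent n} (hx : x ∈ P.ratCochains β Z Γ 0 d) :
    (contr j * lift φ : Module.End K (Finset (Fin m) → Laurent n)) x = 0 := by
  rw [mem_ratCochains] at hx
  ext1 J
  rw [Module.End.mul_apply, contr_apply]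
  split_ifs with hj
  · rfl
  · rw [lift_apply, (hx (insert j J)).2, map_zero, smul_zero, Pi.zero_apply]
    rw [Finset.card_insert_of_notMem hj]
    omega

/-! ### Stability of the weighted pieces under the operators and their inverses. -/

variable (hβ : β * P.alpha = 1) (hΓ : ∀ u ∈ Γ, ∀ v ∈ P.ZAplus, u + v ∈ Γ)
include hβ hΓ

/-- All coordinates of $\mathbf a_0$ are positive, so positivity is automatic. They sum to
$\sum_j\ell_j/\ell_0=1$, which is exactly the room gained when $|J|$ grows by one. -/
theorem pert_mem_ratPiece (d : ℕ) (J : Finset (Fin m)) (i : Fin m) (hi : i ∉ J)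
    (u : Fin n → ℤ) (hu : u ∈ P.expSetLE β Z Γ d J) :
    P.pert i (mono u) ∈ P.ratPiece β Z Γ d (insert i J) := by
  have h0 : (0 : ℚ) < P.l₀ := by exact_mod_cast P.l₀_pos
  have hpos : ∀ j, 0 < coord β P.a₀ j := fun j => by
    have : (0 : ℚ) < P.l j := by exact_mod_cast P.l_pos j
    rw [P.coord_a₀ hβ]; positivity
  obtain ⟨⟨h1, h2, h3, h4⟩, h5⟩ := hu
  have e : (P.l i : K) = ((P.l i : ℚ) : K) := by push_cast; rfl
  rw [pert_mono, e, ratCast_smul_eq]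
  refine Submodule.smul_mem _ _ (Submodule.subset_span ⟨_, ⟨⟨P.add_mem_VZ h1 P.a₀_mem_VZ,
    hΓ u h2 _ (AddSubgroup.subset_closure (Set.mem_insert _ _)), fun j => ?_, fun j _ _ => ?_⟩,
    ?_⟩, rfl⟩)
  · rw [coord_add]; exact add_nonneg (h3 j) (hpos j).le
  · rw [coord_add]; exact add_pos_of_nonneg_of_pos (h3 j) (hpos j)
  · simp only [coord_add, Finset.sum_add_distrib, P.coord_a₀ hβ, ← Finset.sum_div]
    rw [Finset.card_insert_of_notMem hi, ← Nat.cast_sum, ← P.l₀_eq_sum, div_self h0.ne']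
    push_cast
    linarith

/-- Positivity at the new index $i$ costs nothing: the term $x^u$ carries the coefficient $c_i(u)$,
which vanishes when $c_i(u)=0$, and the other term has its $i$-th coordinate raised by one. -/
theorem Dzero_mem_ratPiece (d : ℕ) (J : Finset (Fin m)) (i : Fin m) (hi : i ∉ J)
    (u : Fin n → ℤ) (hu : u ∈ P.expSetLE β Z Γ d J) :
    P.Dzero β i (mono u) ∈ P.ratPiece β Z Γ d (insert i J) := by
  obtain ⟨⟨h1, h2, h3, h4⟩, h5⟩ := hu
  have e : (P.l i : K) = ((P.l i : ℚ) : K) := by push_cast; rfl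
  rw [P.Dzero_mono hβ, e, ratCast_smul_eq (P.l i : ℚ)]
  refine Submodule.add_mem _ ?_ (Submodule.smul_mem _ _ (Submodule.subset_span
    ⟨_, ⟨⟨P.add_mem_VZ h1 (P.a_mem_VZ i), hΓ u h2 _ (AddSubgroup.subset_closure
      (Set.mem_insert_of_mem _ ⟨i, rfl⟩)), fun j => ?_, fun j hj hZ => ?_⟩, ?_⟩, rfl⟩))
  · rcases (h3 i).eq_or_lt with h0 | h0
    · rw [← h0, Rat.cast_zero, zero_smul]; exact Submodule.zero_mem _
    · rw [ratCast_smul_eq]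
      refine Submodule.smul_mem _ _ (Submodule.subset_span
        ⟨_, ⟨⟨h1, h2, h3, fun j hj hZ => ?_⟩, ?_⟩, rfl⟩)
      · rcases Finset.mem_insert.1 hj with rfl | hj
        · exact h0
        · exact h4 j hj hZ
      · rw [Finset.card_insert_of_notMem hi]
        push_cast
        linarith
  · rw [coord_add, P.coord_a hβ]
    have := h3 j
    split_ifs <;> linarith
  · rw [coord_add, P.coord_a hβ]
    have := h3 j
    rcases Finset.mem_insert.1 hj with rfl | hj
    · rw [if_pos rfl]; linarith
    · have := h4 j hj hZ
      split_ifs <;> linarith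
  · simp only [coord_add, Finset.sum_add_distrib, P.coord_a hβ]
    rw [Finset.card_insert_of_notMem hi]
    push_cast
    simp only [Finset.sum_ite_eq', Finset.mem_univ, if_true]
    linarith

theorem sub_nsmul_mem_expSet {J : Finset (Fin m)} {j : Fin m} {u : Fin n → ℤ}
    (hu : u ∈ P.expSet β Z Γ J) {k : ℕ} (hk : (k : ℚ) ≤ coord β u j)
    (hj : j ∈ J → j ∈ Z → (k : ℚ) < coord β u j) :
    u - k • P.a j ∈ P.expSet β Z Γ J := by
  obtain ⟨h1, h2, h3, h4⟩ := hu
  have hc : ∀ i, coord β (u - k • P.a j) i = coord β u i - if i = j then (k : ℚ) else 0 :=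
    fun i => by
      rw [coord_sub, coord_nsmul, P.coord_a hβ]
      split_ifs <;> simp
  refine ⟨P.sub_mem_VZ h1 (P.nsmul_mem_VZ k (P.a_mem_VZ j)), ?_, fun i => ?_, fun i hi hZ => ?_⟩
  · rw [sub_eq_add_neg]
    exact hΓ u h2 _ (P.ZAplus.neg_mem (P.ZAplus.nsmul_mem (AddSubgroup.subset_closure
      (Set.mem_insert_of_mem _ ⟨j, rfl⟩)) k))
  · rw [hc]
    split_ifs with h
    · subst h; linarith
    · linarith [h3 i]
  · rw [hc]
    split_ifs with h
    · subst h; linarith [hj hi hZ]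
    · linarith [h4 i hi hZ]

/-- Only $x^{u-i\mathbf a_j}$ with $1\le i\le\lfloor c_j(u)\rfloor$ occur. The weight drops by at
least one, paying for the smaller $|J|$, and $c_j$ may reach $0$ since $j\notin J$. -/
theorem Dinv_mem_ratPiece (d : ℕ) (j : Fin m) (J : Finset (Fin m)) (hj : j ∉ J)
    (u : Fin n → ℤ) (hu : u ∈ P.expSetLE β Z Γ d (insert j J)) :
    P.Dinv β j (mono u) ∈ P.ratPiece β Z Γ d J := by
  obtain ⟨⟨h1, h2, h3, h4⟩, h5⟩ := hu
  obtain ⟨k, hk⟩ := Int.eq_ofNat_of_zero_le (Int.floor_nonneg.2 (h3 j))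
  rw [Dinv_mono, hk]
  refine P.invPos_mem β j _ k u fun i hi1 hik => Submodule.subset_span ⟨_, ⟨?_, ?_⟩, rfl⟩
  · refine P.sub_nsmul_mem_expSet hβ hΓ
      ⟨h1, h2, h3, fun i hi hZ => h4 i (Finset.mem_insert_of_mem hi) hZ⟩ ?_ fun h => absurd h hj
    have h6 := Int.floor_le (coord β u j)
    rw [hk] at h6
    have h7 : (i : ℚ) ≤ k := by exact_mod_cast hik
    push_cast at h6
    linarith
  · simp only [coord_sub, coord_nsmul, P.coord_a hβ, Finset.sum_sub_distrib, mul_ite, mul_one,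
      mul_zero, Finset.sum_ite_eq', Finset.mem_univ, if_true]
    rw [Finset.card_insert_of_notMem hj] at h5
    have h7 : (1 : ℚ) ≤ i := by exact_mod_cast hi1
    push_cast at h5
    linarith

end Pieces

/-! ### The contraction -/

/-- The differential at `λ = 0`. -/
def nablaZero (β : Matrix (Fin m) (Fin n) ℚ) : Module.End K (Finset (Fin m) → Laurent n) :=
  koszulD (P.Dzero β)

/-- The contraction in the direction `j` with the inverse of `Dzero`. -/
def contrInv (β : Matrix (Fin m) (Fin n) ℚ) (j : Fin m) :
    Module.End K (Finset (Fin m) → Laurent n) := contr j * lift (P.Dinv β j)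

/-- The homotopy at `λ = 0` between the identity and `topProj`. -/
def homotopy (β : Matrix (Fin m) (Fin n) ℚ) : Module.End K (Finset (Fin m) → Laurent n) :=
  homotopySum (P.nablaZero β) ((List.finRange m).map (P.contrInv β))

/-- The projection to the harmonic cochains of top degree. -/
def topProj (β : Matrix (Fin m) (Fin n) ℚ) : Module.End K (Finset (Fin m) → Laurent n) :=
  projProd (P.nablaZero β) ((List.finRange m).map (P.contrInv β))

/-- The perturbation of the homotopy identity. -/
def pertHomotopy (β : Matrix (Fin m) (Fin n) ℚ) :
    Module.End K (Finset (Fin m) → Laurent n) :=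
  koszulD P.pert * P.homotopy β + P.homotopy β * koszulD P.pert

theorem homotopySum_apply_eq_zero {W : Type*} [AddCommGroup W] [Module K W]
    {d : Module.End K W} {l : List (Module.End K W)} {x : W} (h : ∀ φ ∈ l, φ x = 0) :
    homotopySum d l x = 0 := by
  induction l with
  | nil => rfl
  | cons φ t ih =>
    rw [homotopySum, LinearMap.add_apply, Module.End.mul_apply, h φ (by simp),
      ih fun ψ hψ => h ψ (by simp [hψ])]
    simp

theorem homotopySum_apply_mem {W : Type*} [AddCommGroup W] [Module K W] [Module ℚ W]
    {d : Module.End K W} {G : ℕ → Submodule ℚ W} (hd : ∀ k, ∀ x ∈ G k, d x ∈ G (k + 1))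
    {l : List (Module.End K W)} (hl : ∀ φ ∈ l, ∀ k, ∀ x ∈ G (k + 1), φ x ∈ G k)
    (hl0 : ∀ φ ∈ l, ∀ x ∈ G 0, φ x = 0) (k : ℕ) (x : W) (hx : x ∈ G (k + 1)) :
    homotopySum d l x ∈ G k := by
  induction l with
  | nil => exact (G k).zero_mem
  | cons φ t ih =>
    have h1 := ih (fun ψ hψ => hl ψ (by simp [hψ])) fun ψ hψ => hl0 ψ (by simp [hψ])
    set y := homotopySum d t x with hy
    have h2 : d (φ y) ∈ G k := by
      cases k with
      -- In degree $0$ the contraction vanishes, so no cochains of degree $-1$ are needed.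
      | zero => rw [hl0 φ (by simp) y h1, map_zero]; exact (G 0).zero_mem
      | succ k => exact hd k _ (hl φ (by simp) k y h1)
    have h3 : φ (d y) ∈ G k := hl φ (by simp) k _ (hd k y h1)
    have : homotopySum d (φ :: t) x = φ x + (y - (d (φ y) + φ (d y))) := rfl
    rw [this]
    exact (G k).add_mem (hl φ (by simp) k x hx) ((G k).sub_mem h1 ((G k).add_mem h2 h3))

section

variable {β : Matrix (Fin m) (Fin n) ℚ} (hβ : β * P.alpha = 1)
include hβ

theorem nablaZero_mul_self : P.nablaZero β * P.nablaZero β = 0 :=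
  koszulD_mul_self (P.Dzero_comm hβ)

theorem nabla_mul_self : (P.nabla β : Module.End K (Finset (Fin m) → Laurent n)) * P.nabla β = 0 :=
  koszulD_mul_self (P.Dtilde_comm hβ)

omit hβ in
theorem nabla_eq : P.nabla β = P.nablaZero β - (RatFunc.X : K) • koszulD P.pert := by
  refine LinearMap.ext fun x => funext fun J => ?_
  rw [nabla, nablaZero, LinearMap.sub_apply, LinearMap.smul_apply, Pi.sub_apply, Pi.smul_apply,
    koszulD_apply, koszulD_apply, koszulD_apply, Finset.smul_sum, ← Finset.sum_sub_distrib]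
  refine Finset.sum_congr rfl fun j _ => ?_
  rw [Dzero, LinearMap.add_apply, LinearMap.smul_apply, smul_add, smul_comm (RatFunc.X : K)]
  abel

/-- The homotopy built at $\lambda=0$ is kept; replacing $\nabla_0$ by $\nabla$ changes the identity
only by $\lambda$ times a rational operator. -/
theorem nabla_homotopy :
    (P.nabla β : Module.End K (Finset (Fin m) → Laurent n)) * P.homotopy β +
      P.homotopy β * P.nabla β + P.topProj β = 1 - (RatFunc.X : K) • P.pertHomotopy β := by
  have h := homotopySum_anticomm (P.nablaZero_mul_self hβ)
    ((List.finRange m).map (P.contrInv β))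
  change P.nablaZero β * P.homotopy β + P.homotopy β * P.nablaZero β = 1 - P.topProj β at h
  have h' : P.topProj β = 1 - (P.nablaZero β * P.homotopy β + P.homotopy β * P.nablaZero β) := by
    rw [h]; abel
  rw [h', nabla_eq, pertHomotopy, sub_mul, mul_sub, smul_mul_assoc, mul_smul_comm, smul_add]
  abel

theorem one_sub_contrInv_apply (j : Fin m) (x : Finset (Fin m) → Laurent n)
    (J : Finset (Fin m)) :
    (1 - (P.nablaZero β * P.contrInv β j + P.contrInv β j * P.nablaZero β)) x J =
      if j ∈ J then (1 - P.Dzero β j * P.Dinv β j) (x J) else 0 := by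
  rw [nablaZero, contrInv, koszulD_anticomm (P.Dinv_mul_Dzero hβ j)
    fun i hi => P.Dinv_mul_Dzero_of_ne hβ hi, sub_sub_cancel, Module.End.mul_apply,
    Module.End.mul_apply, wedge_mul_contr_apply, lift_apply]

/-- The factor in direction $j$ kills all components with $j\notin J$, so only the component of the
full index set survives all the factors. -/
theorem projProd_apply_eq_zero {l : List (Fin m)} {x : Finset (Fin m) → Laurent n}
    {J : Finset (Fin m)} (h : (∃ j ∈ l, j ∉ J) ∨ x J = 0) :
    projProd (P.nablaZero β) (l.map (P.contrInv β)) x J = 0 := by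
  induction l with
  | nil => simpa [projProd] using h
  | cons j t ih =>
    rw [List.map_cons, projProd, Module.End.mul_apply, P.one_sub_contrInv_apply hβ]
    split_ifs with hj
    · rw [ih, map_zero]
      rcases h with ⟨i, hi, hiJ⟩ | h
      · rcases List.mem_cons.1 hi with rfl | hi
        · exact absurd hj hiJ
        · exact Or.inl ⟨i, hi, hiJ⟩
      · exact Or.inr h
    · rfl

variable {Z : Finset (Fin m)} {Γ : Set (Fin n → ℤ)} (hΓ : ∀ u ∈ Γ, ∀ v ∈ P.ZAplus, u + v ∈ Γ)
include hΓ

/-- The factor for $j$ replaces $c_j$ by its fractional part up to a scalar and leaves the other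
coordinates alone. When strict positivity at $j$ would be lost, that scalar is $0$. -/
theorem projProd_apply_univ_mem (l : List (Fin m)) {x : Finset (Fin m) → Laurent n}
    (hx : x Finset.univ ∈ P.piece β Z Γ Finset.univ) :
    projProd (P.nablaZero β) (l.map (P.contrInv β)) x Finset.univ ∈
      Submodule.span K (mono '' {u | u ∈ P.expSet β Z Γ Finset.univ ∧
        ∀ j ∈ l, coord β u j < 1}) := by
  induction l with
  | nil =>
    refine Submodule.span_mono (Set.image_mono ?_) hx
    intro u hu
    exact ⟨hu, by simp⟩
  | cons j t ih =>
    rw [List.map_cons, projProd, Module.End.mul_apply, P.one_sub_contrInv_apply hβ,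
      if_pos (Finset.mem_univ j)]
    generalize projProd (P.nablaZero β) (t.map (P.contrInv β)) x Finset.univ = y at ih
    induction ih using Submodule.span_induction with
    | mem y hy =>
      obtain ⟨u, ⟨hu, hut⟩, rfl⟩ := hy
      obtain ⟨k, hk⟩ := Int.eq_ofNat_of_zero_le (Int.floor_nonneg.2 (hu.2.2.1 j))
      obtain ⟨r, hr, hr0⟩ := P.exists_one_sub_Dzero_mul_Dinv_mono hβ j k u hk
      rw [hr]
      by_cases hr' : r = 0
      · rw [hr', zero_smul]; exact Submodule.zero_mem _
      have hcj : coord β (u - k • P.a j) j = coord β u j - k := by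
        rw [coord_sub, coord_nsmul, P.coord_a hβ, if_pos rfl, mul_one]
      have hle := Int.floor_le (coord β u j)
      have hlt := Int.lt_floor_add_one (coord β u j)
      rw [hk] at hle hlt
      push_cast at hle hlt
      refine Submodule.smul_mem _ _ (Submodule.subset_span ⟨_, ⟨P.sub_nsmul_mem_expSet hβ hΓ hu
        hle fun _ hZ => ?_, fun i hi => ?_⟩, rfl⟩)
      · refine lt_of_le_of_ne hle fun h => hr' (hr0 ?_ (hu.2.2.2 j (Finset.mem_univ j) hZ))
        rw [hcj, h, sub_self]
      · by_cases hij : i = j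
        · subst hij
          rw [hcj]; linarith
        · rw [coord_sub, coord_nsmul, P.coord_a hβ, if_neg hij, mul_zero, sub_zero]
          exact hut i ((List.mem_cons.1 hi).resolve_left hij)
    | zero => rw [map_zero]; exact Submodule.zero_mem _
    | add y z _ _ hy hz => rw [map_add]; exact Submodule.add_mem _ hy hz
    | smul c y _ hy => rw [map_smul]; exact Submodule.smul_mem _ _ hy

theorem nablaZero_mem_ratCochains {k d : ℕ} {x : Finset (Fin m) → Laurent n}
    (hx : x ∈ P.ratCochains β Z Γ k d) : P.nablaZero β x ∈ P.ratCochains β Z Γ (k + 1) d :=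
  P.koszulD_mem_ratCochains (P.Dzero_mem_ratPiece hβ hΓ d) hx

theorem pert_mem_ratCochains {k d : ℕ} {x : Finset (Fin m) → Laurent n}
    (hx : x ∈ P.ratCochains β Z Γ k d) : koszulD P.pert x ∈ P.ratCochains β Z Γ (k + 1) d :=
  P.koszulD_mem_ratCochains (P.pert_mem_ratPiece hβ hΓ d) hx

theorem homotopy_mem_ratCochains {k d : ℕ} {x : Finset (Fin m) → Laurent n}
    (hx : x ∈ P.ratCochains β Z Γ (k + 1) d) : P.homotopy β x ∈ P.ratCochains β Z Γ k d := by
  refine homotopySum_apply_mem (G := fun k => P.ratCochains β Z Γ k d)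
    (fun k x hx => P.nablaZero_mem_ratCochains hβ hΓ hx) ?_ ?_ k x hx
  · intro φ hφ k x hx
    obtain ⟨j, _, rfl⟩ := List.mem_map.1 hφ
    exact P.contr_mem_ratCochains (P.Dinv_mem_ratPiece hβ hΓ d j) hx
  · intro φ hφ x hx
    obtain ⟨j, _, rfl⟩ := List.mem_map.1 hφ
    exact P.contr_eq_zero_of_mem j hx

omit hβ hΓ in
theorem homotopy_eq_zero {d : ℕ} {x : Finset (Fin m) → Laurent n}
    (hx : x ∈ P.ratCochains β Z Γ 0 d) : P.homotopy β x = 0 := by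
  refine homotopySum_apply_eq_zero fun φ hφ => ?_
  obtain ⟨j, _, rfl⟩ := List.mem_map.1 hφ
  exact P.contr_eq_zero_of_mem j hx

theorem pertHomotopy_mem_ratCochains {k d : ℕ} {x : Finset (Fin m) → Laurent n}
    (hx : x ∈ P.ratCochains β Z Γ k d) : P.pertHomotopy β x ∈ P.ratCochains β Z Γ k d := by
  rw [pertHomotopy, LinearMap.add_apply, Module.End.mul_apply, Module.End.mul_apply]
  refine Submodule.add_mem _ ?_
    (P.homotopy_mem_ratCochains hβ hΓ (P.pert_mem_ratCochains hβ hΓ hx))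
  cases k with
  | zero => rw [P.homotopy_eq_zero hx, map_zero]; exact Submodule.zero_mem _
  | succ k => exact P.pert_mem_ratCochains hβ hΓ (P.homotopy_mem_ratCochains hβ hΓ hx)

/-! ### The variants of the complex: differential, acyclicity, top cohomology -/

theorem map_nabla_cochains_le (k : ℕ) :
    (P.cochains β Z Γ k).map (P.nabla β) ≤ P.cochains β Z Γ (k + 1) := by
  have h1 : (P.cochains β Z Γ k).map (P.nablaZero β) ≤ P.cochains β Z Γ (k + 1) := by
    rw [cochains_eq_unionSpan, cochains_eq_unionSpan]
    exact map_unionSpan_le fun d x hx => P.nablaZero_mem_ratCochains hβ hΓ hx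
  have h2 : (P.cochains β Z Γ k).map (koszulD P.pert) ≤ P.cochains β Z Γ (k + 1) := by
    rw [cochains_eq_unionSpan, cochains_eq_unionSpan]
    exact map_unionSpan_le fun d x hx => P.pert_mem_ratCochains hβ hΓ hx
  rintro _ ⟨x, hx, rfl⟩
  rw [nabla_eq]
  exact Submodule.sub_mem _ (h1 (Submodule.mem_map_of_mem hx))
    (Submodule.smul_mem _ _ (h2 (Submodule.mem_map_of_mem hx)))

theorem map_homotopy_cochains_le (k : ℕ) :
    (P.cochains β Z Γ (k + 1)).map (P.homotopy β) ≤ P.cochains β Z Γ k := by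
  rw [cochains_eq_unionSpan, cochains_eq_unionSpan]
  exact map_unionSpan_le fun d x hx => P.homotopy_mem_ratCochains hβ hΓ hx

/-- The hypothesis $h\nabla x=0$ is weaker than $\nabla x=0$: cocycles give acyclicity, while the
weaker form gives independence of the box monomials in top degree. -/
theorem exists_nabla_eq {k : ℕ} (hk : k < m) {x : Finset (Fin m) → Laurent n}
    (hx : x ∈ P.cochains β Z Γ k) (hhx : P.homotopy β (P.nabla β x) = 0) :
    (k = 0 ∧ x = 0) ∨ ∃ j, k = j + 1 ∧ ∃ y ∈ P.cochains β Z Γ j, P.nabla β y = x := by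
  refine exists_of_contraction (F := P.cochains β Z Γ) (P.nabla_homotopy hβ)
    (P.nabla_mul_self hβ) (P.map_nabla_cochains_le hβ hΓ) (P.map_homotopy_cochains_le hβ hΓ)
    ?_ ?_ ?_ ?_ hk hx hhx
  · intro x hx
    have : (P.cochains β Z Γ 0).map (P.homotopy β) ≤ unionSpan fun _ => ⊥ := by
      rw [cochains_eq_unionSpan]
      exact map_unionSpan_le fun d x hx => (Submodule.mem_bot ℚ).2 (P.homotopy_eq_zero hx)
    simpa [unionSpan] using this (Submodule.mem_map_of_mem hx)
  · intro k hk x hx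
    ext1 J
    refine P.projProd_apply_eq_zero hβ ?_
    by_cases hJ : J.card = k
    · left
      by_contra! h
      have : J = Finset.univ := Finset.eq_univ_iff_forall.2 fun j => h j (List.mem_finRange j)
      rw [this, Finset.card_univ, Fintype.card_fin] at hJ
      omega
    · exact Or.inr ((P.mem_cochains.1 hx J).2 hJ)
  · intro k
    rw [cochains_eq_unionSpan]
    exact unionSpan_le_map_one_sub_X_smul (P.ratCochains_fg hβ k)
      fun d x hx => P.pertHomotopy_mem_ratCochains hβ hΓ hx
  · intro k x hx h0
    rw [cochains_eq_unionSpan] at hx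
    exact one_sub_X_smul_injOn (P.ratCochains_mono k) (P.ratCochains_fg hβ k)
      (fun d x hx => P.pertHomotopy_mem_ratCochains hβ hΓ hx) hx h0

omit hβ hΓ in
theorem cochains_eq_bot {k : ℕ} (hk : m < k) : P.cochains β Z Γ k = ⊥ := by
  rw [eq_bot_iff]
  intro x hx
  rw [Submodule.mem_bot]
  ext1 J
  refine (P.mem_cochains.1 hx J).2 ?_
  have := Finset.card_le_univ J
  rw [Fintype.card_fin] at this
  omega

/-- Write $x=\Phi z$. In top degree $\nabla z=0$, so $x=\nabla hz+pz$, and $pz$ is supported on the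
box. -/
theorem exists_sub_nabla_mem {x : Finset (Fin m) → Laurent n} (hx : x ∈ P.cochains β Z Γ m) :
    ∃ y ∈ P.cochains β Z Γ (m - 1), (x - P.nabla β y) Finset.univ ∈
      Submodule.span K (mono '' P.expBox β Z Γ) := by
  have hsurj : P.cochains β Z Γ m ≤
      (P.cochains β Z Γ m).map (1 - (RatFunc.X : K) • P.pertHomotopy β) := by
    rw [cochains_eq_unionSpan]
    exact unionSpan_le_map_one_sub_X_smul (P.ratCochains_fg hβ m)
      fun d x hx => P.pertHomotopy_mem_ratCochains hβ hΓ hx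
  obtain ⟨z, hz, rfl⟩ := hsurj hx
  have hm : m - 1 + 1 = m := Nat.sub_add_cancel P.m_pos
  have hnz : P.nabla β z = 0 := by
    have := P.map_nabla_cochains_le hβ hΓ m (Submodule.mem_map_of_mem hz)
    rwa [P.cochains_eq_bot (Nat.lt_succ_self m), Submodule.mem_bot] at this
  refine ⟨P.homotopy β z, P.map_homotopy_cochains_le hβ hΓ (m - 1)
    (Submodule.mem_map_of_mem (by rwa [hm])), ?_⟩
  rw [← P.nabla_homotopy hβ]
  have e : ((P.nabla β : Module.End K (Finset (Fin m) → Laurent n)) * P.homotopy β +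
      P.homotopy β * P.nabla β + P.topProj β) z - P.nabla β (P.homotopy β z) =
      P.topProj β z := by
    simp [hnz]
  rw [e]
  have h1 := P.projProd_apply_univ_mem hβ hΓ (List.finRange m)
    ((P.mem_cochains.1 hz Finset.univ).1 (by simp))
  refine Submodule.span_mono (Set.image_mono ?_) h1
  rintro u ⟨hu, h2⟩
  exact ⟨hu, fun j => h2 j (List.mem_finRange j)⟩

/-- Every `Dinv` kills box monomials, hence $h\nabla y=0$. Since $y$ has degree $m-1$, it is zero or
a coboundary, and in both cases $\nabla y=0$. -/
theorem eq_zero_of_single_eq_nabla {s : Laurent n}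
    (hs : s ∈ Submodule.span K (mono '' P.expBox β Z Γ)) {y : Finset (Fin m) → Laurent n}
    (hy : y ∈ P.cochains β Z Γ (m - 1)) (h : P.nabla β y = Pi.single Finset.univ s) : s = 0 := by
  have hinv : ∀ j, P.Dinv β j s = 0 := fun j => by
    have : Submodule.span K (mono '' P.expBox β Z Γ) ≤ LinearMap.ker (P.Dinv β j) := by
      rw [Submodule.span_le]
      rintro _ ⟨u, ⟨hu, hu1⟩, rfl⟩
      exact P.Dinv_mono_of_lt β (hu.2.2.1 j) (hu1 j)
    exact this hs
  have hh : P.homotopy β (P.nabla β y) = 0 := by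
    refine homotopySum_apply_eq_zero fun φ hφ => ?_
    obtain ⟨j, _, rfl⟩ := List.mem_map.1 hφ
    ext1 J
    rw [h, contrInv, Module.End.mul_apply, contr_apply]
    split_ifs
    · rfl
    · rw [lift_apply]
      by_cases hJ : insert j J = Finset.univ
      · rw [hJ, Pi.single_eq_same, hinv, smul_zero]; rfl
      · rw [Pi.single_eq_of_ne hJ, map_zero, smul_zero]; rfl
  have h0 : P.nabla β y = 0 := by
    rcases P.exists_nabla_eq hβ hΓ (Nat.sub_lt P.m_pos one_pos) hy hh with ⟨_, rfl⟩ |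
      ⟨j, _, z, _, rfl⟩
    · exact map_zero _
    · exact LinearMap.congr_fun (P.nabla_mul_self hβ) z
  rw [h] at h0
  simpa using congrFun h0 Finset.univ

end

end Data

/-! ### Classes in a quotient -/

section Quotient

variable {V ι : Type*} [AddCommGroup V] [Module K V] {C R : Submodule K V} {v : ι → V}

theorem linearIndependent_mkQ (hv : ∀ i, v i ∈ C) (hli : LinearIndependent K v)
    (h : ∀ s ∈ Submodule.span K (Set.range v), s ∈ R → s = 0) :
    LinearIndependent K fun i => (R.submoduleOf C).mkQ ⟨v i, hv i⟩ := by
  have h1 : LinearIndependent K fun i => (⟨v i, hv i⟩ : C) :=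
    LinearIndependent.of_comp C.subtype hli
  refine h1.map ?_
  rw [Submodule.ker_mkQ, Submodule.disjoint_def]
  intro x hx hxR
  refine Subtype.ext (h x ?_ hxR)
  have := Submodule.mem_map_of_mem (f := C.subtype) hx
  rwa [Submodule.map_span, ← Set.range_comp] at this

theorem mkQ_mem_span (hv : ∀ i, v i ∈ C) (hRC : R ≤ C) {x r : V} (hx : x ∈ C) (hr : r ∈ R)
    (h : x - r ∈ Submodule.span K (Set.range v)) :
    (R.submoduleOf C).mkQ ⟨x, hx⟩ ∈
      Submodule.span K (Set.range fun i => (R.submoduleOf C).mkQ ⟨v i, hv i⟩) := by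
  have e : (R.submoduleOf C).mkQ ⟨x, hx⟩ =
      (R.submoduleOf C).mkQ ⟨x - r, C.sub_mem hx (hRC hr)⟩ := by
    refine (Submodule.Quotient.eq _).2 ?_
    change x - (x - r) ∈ R
    rwa [sub_sub_cancel]
  have h1 : Submodule.span K (Set.range v) =
      (Submodule.span K (Set.range fun i => (⟨v i, hv i⟩ : C))).map C.subtype := by
    rw [Submodule.map_span, ← Set.range_comp]; rfl
  rw [h1] at h
  obtain ⟨y, hy, hyx⟩ := h
  have h2 : (⟨x - r, C.sub_mem hx (hRC hr)⟩ : C) = y := Subtype.ext hyx.symm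
  rw [e, h2]
  have := Submodule.mem_map_of_mem (f := (R.submoduleOf C).mkQ) hy
  rwa [Submodule.map_span, ← Set.range_comp] at this

end Quotient

namespace Data

variable {m n : ℕ} (P : Data m n)

/-- Real independence of integer vectors makes $\alpha$ injective over $\mathbb Q$. This supplies
coordinates for the assertions that do not mention $\beta$. -/
theorem exists_mul_alpha_eq_one : ∃ β : Matrix (Fin m) (Fin n) ℚ, β * P.alpha = 1 := by
  have hinj : LinearMap.ker P.alpha.mulVecLin = ⊥ := by
    rw [LinearMap.ker_eq_bot']
    intro c hc
    have h := Fintype.linearIndependent_iff.1 P.linInd (fun j => (c j : ℝ)) (by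
      ext i
      have h1 : ∑ j, (P.a j i : ℚ) * c j = 0 := by
        have := congrFun hc i
        simpa [Matrix.mulVec, dotProduct, alpha] using this
      have h2 : ∑ j, (P.a j i : ℝ) * (c j : ℝ) = 0 := by exact_mod_cast h1
      simpa [toReal, mul_comm] using h2)
    ext j
    simpa using h j
  obtain ⟨g, hg⟩ := LinearMap.exists_leftInverse_of_injective _ hinj
  refine ⟨LinearMap.toMatrix' g, ?_⟩
  have h1 : LinearMap.toMatrix' (P.alpha.mulVecLin) = P.alpha := LinearMap.toMatrix'_toLin' _
  rw [← h1, ← LinearMap.toMatrix'_comp, hg, LinearMap.toMatrix'_id]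

/-! ### Cones and interiors in coordinates -/

/-- Coordinates identify $V$ homeomorphically with $\mathbb R^m$, where the interior of a finite
product is the product of the interiors. -/
theorem mem_interiorInV_iff_repr {s : Fin m → Set ℝ} {X : Set (Fin n → ℝ)}
    (hX : ∀ x, x ∈ X ↔ ∃ c : Fin m → ℝ, (∀ j, c j ∈ s j) ∧ x = ∑ j, c j • toReal (P.a j))
    {x : Fin n → ℝ} : x ∈ P.interiorInV X ↔
      ∃ c : Fin m → ℝ, (∀ j, c j ∈ interior (s j)) ∧ x = ∑ j, c j • toReal (P.a j) := by
  let b : Module.Basis (Fin m) ℝ P.V := Module.Basis.span P.linInd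
  let e := b.equivFun.toContinuousLinearEquiv
  have hb : ∀ v : P.V, (v : Fin n → ℝ) = ∑ j, e v j • toReal (P.a j) := fun v => by
    have h1 := b.sum_equivFun v
    have h2 := congrArg (Subtype.val) h1
    rw [← h2]
    simp only [Submodule.coe_sum, Submodule.coe_smul]
    refine Finset.sum_congr rfl fun j _ => ?_
    congr 1
    exact congrArg Subtype.val (Module.Basis.span_apply P.linInd j)
  have huniq : ∀ (v : P.V) (c : Fin m → ℝ), (v : Fin n → ℝ) = ∑ j, c j • toReal (P.a j) →
      e v = c := fun v c h => by
    have h1 := h.symm.trans (hb v)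
    have := P.linInd.fintypeLinearCombination_injective (a₁ := c) (a₂ := e v) (by
      simpa [Fintype.linearCombination_apply] using h1)
    exact this.symm
  have hpre : {v : P.V | (v : Fin n → ℝ) ∈ X} = e ⁻¹' Set.univ.pi s := by
    ext v
    rw [Set.mem_ofPred_eq, hX, Set.mem_preimage, Set.mem_univ_pi]
    constructor
    · rintro ⟨c, hc, hv⟩
      rw [huniq v c hv]
      exact hc
    · exact fun h => ⟨e v, h, hb v⟩
  have hint : interior {v : P.V | (v : Fin n → ℝ) ∈ X} =
      e ⁻¹' Set.univ.pi fun j => interior (s j) := by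
    rw [hpre, ← interior_pi_set Set.finite_univ]
    exact (e.toHomeomorph.preimage_interior _).symm
  rw [interiorInV, hint]
  constructor
  · rintro ⟨v, hv, rfl⟩
    exact ⟨e v, fun j => hv j (Set.mem_univ j), hb v⟩
  · rintro ⟨c, hc, hx⟩
    have hxV : x ∈ P.V := by
      rw [hx]
      exact P.V.sum_mem fun j _ => P.V.smul_mem _ (Submodule.subset_span ⟨j, rfl⟩)
    refine ⟨⟨x, hxV⟩, fun j _ => ?_, rfl⟩
    rw [huniq ⟨x, hxV⟩ c hx]
    exact hc j

section

variable {β : Matrix (Fin m) (Fin n) ℚ} (hβ : β * P.alpha = 1)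
include hβ

theorem exists_repr_iff {u : Fin n → ℤ} (hu : u ∈ P.VZ) (p : Fin m → ℝ → Prop) :
    (∃ c : Fin m → ℝ, (∀ j, p j (c j)) ∧ toReal u = ∑ j, c j • toReal (P.a j)) ↔
      ∀ j, p j (coord β u j) := by
  constructor
  · rintro ⟨c, hc, h⟩ j
    rw [P.coord_eq_of_sum hβ h]
    exact hc j
  · exact fun h => ⟨fun j => coord β u j, h, P.toReal_eq_sum_coord hβ hu⟩

theorem mem_cone_iff {u : Fin n → ℤ} (hu : u ∈ P.VZ) (B : Finset (Fin m)) :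
    toReal u ∈ P.cone B ↔ (∀ j, 0 ≤ coord β u j) ∧ ∀ j ∉ B, coord β u j = 0 := by
  have h1 : toReal u ∈ P.cone B ↔ ∃ c : Fin m → ℝ, (∀ j, 0 ≤ c j ∧ (j ∉ B → c j = 0)) ∧
      toReal u = ∑ j, c j • toReal (P.a j) := by
    constructor
    · rintro ⟨c, hc, h⟩
      refine ⟨fun j => if j ∈ B then c j else 0, fun j => ?_, ?_⟩
      · by_cases hj : j ∈ B
        · simp [hj, hc j hj]
        · simp [hj]
      · rw [h]
        simp [ite_smul]
    · rintro ⟨c, hc, h⟩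
      refine ⟨c, fun j _ => (hc j).1, h.trans (Eq.symm ?_)⟩
      refine Finset.sum_subset (Finset.subset_univ B) fun j _ hj => ?_
      rw [(hc j).2 hj, zero_smul]
  rw [h1, P.exists_repr_iff hβ hu fun j x => 0 ≤ x ∧ (j ∉ B → x = 0), forall_and]
  norm_cast

theorem mem_M_iff {u : Fin n → ℤ} : u ∈ P.M ↔ u ∈ P.VZ ∧ ∀ j, 0 ≤ coord β u j := by
  refine and_congr_right fun hu => ?_
  rw [P.mem_cone_iff hβ hu]
  simp

theorem mem_latticeB_iff {u : Fin n → ℤ} :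
    u ∈ P.latticeB ↔ u ∈ P.VZ ∧ ∀ j, 0 ≤ coord β u j ∧ coord β u j < 1 := by
  refine and_congr_right fun hu => ?_
  refine (P.exists_repr_iff hβ hu fun _ x => 0 ≤ x ∧ x < 1).trans ?_
  norm_cast

theorem mem_interior_cone_iff {u : Fin n → ℤ} (hu : u ∈ P.VZ) :
    toReal u ∈ P.interiorInV (P.cone Finset.univ) ↔ ∀ j, 0 < coord β u j := by
  rw [P.mem_interiorInV_iff_repr (s := fun _ => Set.Ici 0) (fun x => by simp [cone])]
  refine (P.exists_repr_iff hβ hu fun _ x => x ∈ interior (Set.Ici 0)).trans ?_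
  simp

theorem mem_interior_parallelepiped_iff {u : Fin n → ℤ} (hu : u ∈ P.VZ) :
    toReal u ∈ P.interiorInV P.parallelepiped ↔
      ∀ j, 0 < coord β u j ∧ coord β u j < 1 := by
  rw [P.mem_interiorInV_iff_repr (s := fun _ => Set.Ico 0 1)
    (fun x => by simp [parallelepiped])]
  refine (P.exists_repr_iff hβ hu fun _ x => x ∈ interior (Set.Ico 0 1)).trans ?_
  simp only [interior_Ico, Set.mem_Ioo]
  norm_cast

theorem latticeB_finite : P.latticeB.Finite := by
  refine (P.finite_of_coord_bounded hβ 1).subset fun u hu => ?_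
  obtain ⟨h1, h2⟩ := (P.mem_latticeB_iff hβ).1 hu
  exact ⟨h1, fun j => ⟨(h2 j).1, (h2 j).2.le⟩⟩

theorem expBox_univ_eq :
    P.expBox β Finset.univ Set.univ =
      {b | b ∈ P.latticeB ∧ toReal b ∈ P.interiorInV (P.cone Finset.univ)} := by
  ext u
  constructor
  · rintro ⟨⟨h1, _, h2, h3⟩, h4⟩
    exact ⟨(P.mem_latticeB_iff hβ).2 ⟨h1, fun j => ⟨h2 j, h4 j⟩⟩,
      (P.mem_interior_cone_iff hβ h1).2 fun j => h3 j (Finset.mem_univ j) (Finset.mem_univ j)⟩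
  · rintro ⟨h1, h2⟩
    obtain ⟨h3, h4⟩ := (P.mem_latticeB_iff hβ).1 h1
    exact ⟨⟨h3, Set.mem_univ _, fun j => (h4 j).1,
      fun j _ _ => (P.mem_interior_cone_iff hβ h3).1 h2 j⟩, fun j => (h4 j).2⟩

theorem expBox_coset_eq (c : Fin n → ℤ) :
    P.expBox β Finset.univ {u | u - c ∈ P.ZAplus} =
      {b | b ∈ P.latticeB ∧ b - c ∈ P.ZAplus ∧ toReal b ∈ P.interiorInV P.parallelepiped} := by
  ext u
  constructor
  · rintro ⟨⟨h1, hc, h2, h3⟩, h4⟩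
    exact ⟨(P.mem_latticeB_iff hβ).2 ⟨h1, fun j => ⟨h2 j, h4 j⟩⟩, hc,
      (P.mem_interior_parallelepiped_iff hβ h1).2 fun j =>
        ⟨h3 j (Finset.mem_univ j) (Finset.mem_univ j), h4 j⟩⟩
  · rintro ⟨h1, hc, h2⟩
    obtain ⟨h3, h4⟩ := (P.mem_latticeB_iff hβ).1 h1
    exact ⟨⟨h3, hc, fun j => (h4 j).1,
      fun j _ _ => ((P.mem_interior_parallelepiped_iff hβ h3).1 h2 j).1⟩, fun j => (h4 j).2⟩

theorem sum_ncard_cone_eq :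
    ∑ B : Finset (Fin m), (-1 : ℤ) ^ (Finset.univ \ B).card *
      ({b | b ∈ P.latticeB ∧ toReal b ∈ P.cone B}.ncard : ℤ) =
    ({b | b ∈ P.latticeB ∧ toReal b ∈ P.interiorInV (P.cone Finset.univ)}.ncard : ℤ) := by
  classical
  set F := (P.latticeB_finite hβ).toFinset with hF
  have hcard : ∀ p : (Fin n → ℤ) → Prop, ({b | b ∈ P.latticeB ∧ p b}.ncard : ℤ) =
      ∑ b ∈ F, if p b then 1 else 0 := fun p => by
    have : {b | b ∈ P.latticeB ∧ p b} = (F.filter p : Finset (Fin n → ℤ)) := by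
      ext b; simp [hF]
    rw [this, Set.ncard_coe_finset, Finset.card_filter]
    push_cast
    rfl
  simp only [hcard, Finset.mul_sum]
  rw [Finset.sum_comm]
  refine Finset.sum_congr rfl fun b hb => ?_
  obtain ⟨hV, hb1⟩ := (P.mem_latticeB_iff hβ).1 ((Set.Finite.mem_toFinset _).1 hb)
  set N := Finset.univ.filter fun j => coord β b j = 0 with hN
  have h1 : ∀ B : Finset (Fin m), toReal b ∈ P.cone Bᶜ ↔ B ⊆ N := fun B => by
    rw [P.mem_cone_iff hβ hV, and_iff_right fun j => (hb1 j).1]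
    simp [hN, Finset.subset_iff]
  have h2 : toReal b ∈ P.interiorInV (P.cone Finset.univ) ↔ N = ∅ := by
    rw [P.mem_interior_cone_iff hβ hV, Finset.eq_empty_iff_forall_notMem]
    refine forall_congr' fun j => ?_
    rw [hN, Finset.mem_filter, and_iff_right (Finset.mem_univ j)]
    exact ⟨fun h => h.ne', fun h => lt_of_le_of_ne (hb1 j).1 (Ne.symm h)⟩
  -- Summing over complements, $b$ contributes $\sum_{B\subseteq N}(-1)^{|B|}$ with $N$ its set of
  -- vanishing coordinates; this is $1$ if $N=\emptyset$ and $0$ otherwise.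
  rw [← (Equiv.ofBijective _ (compl_bijective (α := Finset (Fin m)))).sum_comp]
  simp only [Equiv.ofBijective_apply, ← Finset.compl_eq_univ_sdiff, compl_compl, h1, h2]
  rw [← Finset.sum_powerset_neg_one_pow_card]
  simp only [mul_ite, mul_one, mul_zero]
  rw [← Finset.sum_filter]
  refine Finset.sum_congr ?_ fun _ _ => rfl
  ext B
  simp

/-! ### The complex `𝒦(A, A)` -/

theorem S_eq_piece (J : Finset (Fin m)) : P.S J = P.piece β Finset.univ Set.univ J := by
  unfold S piece
  congr 2
  ext u
  constructor
  · rintro ⟨hM, c, hc, h⟩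
    obtain ⟨h1, h2⟩ := (P.mem_M_iff hβ).1 hM
    refine ⟨h1, Set.mem_univ _, h2, fun j hj _ => ?_⟩
    have := h j hj
    rw [← P.coord_eq_of_sum hβ hc] at this
    exact_mod_cast this
  · rintro ⟨h1, _, h2, h3⟩
    refine ⟨(P.mem_M_iff hβ).2 ⟨h1, h2⟩, fun j => coord β u j, P.toReal_eq_sum_coord hβ h1,
      fun j hj => ?_⟩
    exact Rat.cast_pos.2 (h3 j hj (Finset.mem_univ j))

theorem S_empty_eq_piece (J : Finset (Fin m)) : P.S ∅ = P.piece β ∅ Set.univ J := by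
  rw [P.S_eq_piece hβ]
  unfold piece expSet
  simp

theorem kAA_eq (k : ℕ) : P.kAA k = P.cochains β Finset.univ Set.univ k := by
  rw [kAA, cochains]
  congr 1
  exact funext (P.S_eq_piece hβ)

theorem kos_eq (k : ℕ) : P.kos k = P.cochains β ∅ Set.univ k := by
  rw [kos, cochains]
  congr 1
  exact funext (P.S_empty_eq_piece hβ)

omit hβ in
theorem kAA_le_kos (k : ℕ) : P.kAA k ≤ P.kos k := by
  intro x hx
  simp only [kAA, kos, koszulCochains, Submodule.mem_pi, Set.mem_univ, true_imp_iff] at hx ⊢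
  intro J
  have := hx J
  split_ifs at this ⊢
  · refine Submodule.span_mono (Set.image_mono ?_) this
    rintro u ⟨hu, c, hc, _⟩
    exact ⟨hu, c, hc, by simp⟩
  · exact this

omit hβ in
theorem coboundaries_eq {k : ℕ} (hk : 0 < k) :
    P.coboundaries β k = (P.kAA (k - 1)).map (P.nabla β) := by
  cases k with
  | zero => omega
  | succ k => rfl

omit hβ in
theorem univ_add_mem (u : Fin n → ℤ) (_ : u ∈ (Set.univ : Set (Fin n → ℤ))) (v : Fin n → ℤ)
    (_ : v ∈ P.ZAplus) : u + v ∈ (Set.univ : Set (Fin n → ℤ)) := Set.mem_univ _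

theorem subsingleton_H {i : ℕ} (hi : i < m) : Subsingleton (P.H β i) := by
  rw [H, Submodule.Quotient.subsingleton_iff, eq_top_iff]
  rintro ⟨x, hx, hx0⟩ -
  change x ∈ P.coboundaries β i
  rw [P.kAA_eq hβ] at hx
  have h0 : P.nabla β x = 0 := hx0
  rcases P.exists_nabla_eq hβ (P.univ_add_mem) hi hx (by rw [h0, map_zero]) with
    ⟨_, rfl⟩ | ⟨j, rfl, y, hy, rfl⟩
  · exact Submodule.zero_mem _
  · rw [← P.kAA_eq hβ] at hy
    exact Submodule.mem_map_of_mem hy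

/-- The classes of the interior box monomials, placed in the top component, form a basis. -/
theorem finite_and_finrank_H : Module.Finite K (P.H β m) ∧ Module.finrank K (P.H β m) =
    {b | b ∈ P.latticeB ∧ toReal b ∈ P.interiorInV (P.cone Finset.univ)}.ncard := by
  rw [← P.expBox_univ_eq hβ]
  set X := P.expBox β Finset.univ Set.univ with hX
  have hΓ := P.univ_add_mem
  have hXfin : X.Finite := by
    rw [hX, P.expBox_univ_eq hβ]
    exact (P.latticeB_finite hβ).subset fun b hb => hb.1
  have hcoc : P.cocycles β m = P.cochains β Finset.univ Set.univ m := by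
    rw [cocycles, P.kAA_eq hβ, inf_eq_left]
    intro x hx
    have := P.map_nabla_cochains_le hβ hΓ m (Submodule.mem_map_of_mem hx)
    rwa [P.cochains_eq_bot (Nat.lt_succ_self m), Submodule.mem_bot] at this
  have hcob : P.coboundaries β m = (P.cochains β Finset.univ Set.univ (m - 1)).map (P.nabla β) := by
    rw [P.coboundaries_eq P.m_pos, P.kAA_eq hβ]
  have hle : P.coboundaries β m ≤ P.cocycles β m := by
    rw [hcoc, hcob]
    have := P.map_nabla_cochains_le (Z := Finset.univ) hβ hΓ (m - 1)
    rwa [Nat.sub_add_cancel P.m_pos] at this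
  let v : X → Finset (Fin m) → Laurent n := fun b =>
    LinearMap.single K (fun _ => Laurent n) Finset.univ (mono b.1)
  have hrange : Submodule.span K (Set.range v) = (Submodule.span K (mono '' X)).map
      (LinearMap.single K (fun _ : Finset (Fin m) => Laurent n) Finset.univ) := by
    rw [Submodule.map_span, Set.image_image]
    congr 1
    ext y
    simp [v]
  have hv : ∀ b, v b ∈ P.cocycles β m := fun b => by
    rw [hcoc]
    have := P.single_mem_cochains (β := β) (Z := Finset.univ) (Γ := Set.univ)
      (J := Finset.univ) (Submodule.subset_span ⟨b.1, b.2.1, rfl⟩)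
    rwa [Finset.card_univ, Fintype.card_fin] at this
  have hli : LinearIndependent K v :=
    (linearIndependent_mono.comp _ Subtype.val_injective).map' _
      (LinearMap.ker_eq_bot.2 (Pi.single_injective (M := fun _ : Finset (Fin m) => Laurent n) Finset.univ))
  have hLI := linearIndependent_mkQ hv hli (R := P.coboundaries β m) (by
    rintro s hs hsR
    rw [hrange] at hs
    obtain ⟨t, ht, rfl⟩ := hs
    rw [hcob] at hsR
    obtain ⟨y, hy, hyt⟩ := hsR
    rw [P.eq_zero_of_single_eq_nabla hβ hΓ ht hy hyt, map_zero])
  have hspan : ⊤ ≤ Submodule.span K (Set.range fun i =>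
      ((P.coboundaries β m).submoduleOf (P.cocycles β m)).mkQ ⟨v i, hv i⟩) := by
    intro q _
    obtain ⟨⟨x, hx⟩, rfl⟩ := Submodule.mkQ_surjective _ q
    have hx' := hx
    rw [hcoc] at hx'
    obtain ⟨y, hy, hxy⟩ := P.exists_sub_nabla_mem hβ hΓ hx'
    have hr : P.nabla β y ∈ P.coboundaries β m := by
      rw [hcob]; exact Submodule.mem_map_of_mem hy
    refine mkQ_mem_span hv hle hx hr ?_
    have h1 : x - P.nabla β y ∈ P.cochains β Finset.univ Set.univ m :=
      hcoc ▸ Submodule.sub_mem _ hx (hle hr)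
    rw [P.eq_single_univ_of_mem h1, hrange]
    exact Submodule.mem_map_of_mem hxy
  have : Finite X := hXfin
  let b := Module.Basis.mk hLI hspan
  have := Fintype.ofFinite X
  exact ⟨Module.Finite.of_basis b, by
    rw [Module.finrank_eq_card_basis b, ← Nat.card_eq_fintype_card]; rfl⟩

/-! ### The quotients for the cosets -/

omit hβ in
theorem Scoset_eq_piece (hβ : β * P.alpha = 1) (c : Fin n → ℤ) (J : Finset (Fin m)) :
    P.Scoset c = P.piece β ∅ {u | u - c ∈ P.ZAplus} J := by
  unfold Scoset piece
  congr 2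
  ext u
  simp only [Mcoset, expSet, Set.mem_ofPred_eq, P.mem_M_iff hβ]
  simp
  tauto

omit hβ in
theorem coset_add_mem (c u : Fin n → ℤ) (hu : u ∈ {u | u - c ∈ P.ZAplus}) (v : Fin n → ℤ)
    (hv : v ∈ P.ZAplus) : u + v ∈ {u | u - c ∈ P.ZAplus} := by
  change u + v - c ∈ P.ZAplus
  rw [add_sub_right_comm]
  exact P.ZAplus.add_mem hu hv

/-- On exponents in $V$ a vector is recovered from its coordinates, so the $D_i$ are combinations of
the $\tilde D_j$; both families thus give the same relations on $S'_{\mathcal C}$. -/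
theorem D_eq_sum_Dtilde (i : Fin n) {t : Laurent n}
    (ht : t ∈ Submodule.span K (mono '' P.VZ)) :
    P.D i t = ∑ j, ((P.a j i : ℤ) : K) • P.Dtilde β j t := by
  have : Set.EqOn (P.D i) (∑ j, ((P.a j i : ℤ) : K) • P.Dtilde β j : Module.End K (Laurent n))
      (Submodule.span K (mono '' P.VZ)) := by
    refine LinearMap.eqOn_span ?_
    rintro _ ⟨u, hu, rfl⟩
    have e1 : ((u i : ℤ) : K) = ∑ j, ((P.a j i : ℤ) : K) * (coord β u j : K) := by
      have := congrArg (fun q : ℚ => (q : K)) (P.apply_eq_sum_coord hβ hu i)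
      push_cast at this
      rw [this]
      exact Finset.sum_congr rfl fun j _ => mul_comm _ _
    have e2 : (P.l₀ : K) * RatFunc.X * ((P.a₀ i : ℤ) : K) =
        ∑ j, ((P.a j i : ℤ) : K) * (RatFunc.X * (P.l j : K)) := by
      have h1 : (P.l₀ : ℤ) * P.a₀ i = ∑ j, (P.l j : ℤ) * P.a j i := by
        have := congrFun P.relation i
        simpa using this
      have h2 : (P.l₀ : K) * ((P.a₀ i : ℤ) : K) = ∑ j, (P.l j : K) * ((P.a j i : ℤ) : K) := by
        exact_mod_cast congrArg (fun z : ℤ => (z : K)) h1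
      rw [mul_right_comm, h2, Finset.sum_mul]
      exact Finset.sum_congr rfl fun j _ => by ring
    rw [P.D_mono, LinearMap.sum_apply, e1, e2]
    simp only [LinearMap.smul_apply, P.Dtilde_mono hβ, smul_add, smul_sub, smul_smul,
      Finset.sum_sub_distrib, Finset.sum_add_distrib, Finset.sum_smul, mul_comm (P.l _ : K)]
  have h := this ht
  rw [h, LinearMap.sum_apply]
  rfl

omit hβ in
theorem Dtilde_mem_relCoset (j : Fin m) {c : Fin n → ℤ} {t : Laurent n} (ht : t ∈ P.Scoset c) :
    P.Dtilde β j t ∈ P.relCoset c := by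
  rw [Dtilde, LinearMap.sum_apply]
  exact Submodule.sum_mem _ fun i _ => Submodule.smul_mem _ _
    (Submodule.mem_iSup_of_mem i (Submodule.mem_map_of_mem ht))

/-- A cochain supported on the complement of $j$ has $\nabla$ equal in the top component to
$\pm\tilde D_j$ of its entry; the witness absorbs the sign. -/
theorem exists_single_Dtilde_eq_nabla {Γ : Set (Fin n → ℤ)}
    (hΓ : ∀ u ∈ Γ, ∀ v ∈ P.ZAplus, u + v ∈ Γ) (j : Fin m) {t : Laurent n}
    (ht : ∀ J, t ∈ P.piece β ∅ Γ J) :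
    ∃ y ∈ P.cochains β ∅ Γ (m - 1), P.nabla β y = Pi.single Finset.univ (P.Dtilde β j t) := by
  set y : Finset (Fin m) → Laurent n :=
    Pi.single (Finset.univ.erase j) (wedgeSign j Finset.univ • t) with hy
  have hyc : y ∈ P.cochains β ∅ Γ (m - 1) := by
    have := P.single_mem_cochains (J := Finset.univ.erase j)
      (Submodule.smul_mem _ (wedgeSign j Finset.univ) (ht (Finset.univ.erase j)))
    rwa [Finset.card_erase_of_mem (Finset.mem_univ j), Finset.card_univ, Fintype.card_fin] at this
  refine ⟨y, hyc, ?_⟩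
  have h1 := P.map_nabla_cochains_le hβ hΓ (m - 1) (Submodule.mem_map_of_mem hyc)
  rw [Nat.sub_add_cancel P.m_pos] at h1
  rw [P.eq_single_univ_of_mem h1]
  congr 1
  rw [nabla, koszulD_apply, Finset.sum_eq_single j]
  · rw [hy, Pi.single_eq_same, map_smul, smul_smul, wedgeSign_mul_self, one_smul]
  · intro i _ hij
    have : Finset.univ.erase i ≠ Finset.univ.erase j := fun h =>
      Finset.notMem_erase j Finset.univ (h ▸ Finset.mem_erase.2 ⟨hij.symm, Finset.mem_univ j⟩)
    rw [hy, Pi.single_eq_of_ne this, map_zero, smul_zero]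
  · exact fun h => absurd (Finset.mem_univ j) h

theorem relCoset_le (c : Fin n → ℤ) :
    P.relCoset c ≤ ((P.cochains β ∅ {u | u - c ∈ P.ZAplus} (m - 1)).map (P.nabla β)).comap
      (LinearMap.single K (fun _ : Finset (Fin m) => Laurent n) Finset.univ) := by
  refine iSup_le fun i => ?_
  rintro _ ⟨t, ht, rfl⟩
  have htV : t ∈ Submodule.span K (mono '' P.VZ) :=
    Submodule.span_mono (Set.image_mono fun u hu => hu.1.1) ht
  rw [P.D_eq_sum_Dtilde hβ i htV]
  refine Submodule.sum_mem _ fun j _ => Submodule.smul_mem _ _ ?_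
  obtain ⟨y, hy, h⟩ := P.exists_single_Dtilde_eq_nabla hβ (P.coset_add_mem c) j
    (fun J => P.Scoset_eq_piece hβ c J ▸ ht)
  exact ⟨y, hy, h⟩

theorem relCoset_le_Scoset (c : Fin n → ℤ) : P.relCoset c ≤ P.Scoset c := by
  intro s hs
  obtain ⟨y, hy, h⟩ := P.relCoset_le hβ c hs
  have h1 := P.map_nabla_cochains_le hβ (P.coset_add_mem c) (m - 1)
    (Submodule.mem_map_of_mem hy)
  rw [Nat.sub_add_cancel P.m_pos, h] at h1
  have := (P.mem_cochains.1 h1 Finset.univ).1 (by simp)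
  rw [P.Scoset_eq_piece hβ c Finset.univ]
  simpa using this

theorem rank_What (c : Fin n → ℤ) : Module.rank K (P.What c) = (P.R c : Cardinal) := by
  set Γ : Set (Fin n → ℤ) := {u | u - c ∈ P.ZAplus} with hΓdef
  have hΓ := P.coset_add_mem c
  have hR : P.R c = (P.expBox β Finset.univ Γ).ncard := by rw [R, ← P.expBox_coset_eq hβ]
  rw [hR]
  set X := P.expBox β Finset.univ Γ with hX
  have hXfin : X.Finite := by
    rw [hX, hΓdef, P.expBox_coset_eq hβ]
    exact (P.latticeB_finite hβ).subset fun b hb => hb.1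
  have hXM : ∀ b ∈ X, b ∈ P.Mcoset c := fun b hb =>
    ⟨(P.mem_M_iff hβ).2 ⟨hb.1.1, hb.1.2.2.1⟩, hb.1.2.1⟩
  let v : X → Laurent n := fun b => mono b.1
  have hrange : Set.range v = mono '' X := by
    ext y; simp [v]
  have hv : ∀ b, v b ∈ P.Scoset c := fun b => Submodule.subset_span ⟨b.1, hXM b.1 b.2, rfl⟩
  have hLI := linearIndependent_mkQ hv (linearIndependent_mono.comp _ Subtype.val_injective)
    (R := P.relCoset c) (by
      rintro s hs hsR
      rw [hrange] at hs
      obtain ⟨y, hy, hys⟩ := P.relCoset_le hβ c hsR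
      -- Independence is tested in the complex with empty $Z$, since the relations come from all of
      -- $S'_{\mathcal C}$; its box contains the interior box.
      refine P.eq_zero_of_single_eq_nabla hβ hΓ (Submodule.span_mono (Set.image_mono ?_) hs) hy hys
      rintro u ⟨⟨h1, h2, h3, _⟩, h4⟩
      exact ⟨⟨h1, h2, h3, fun j _ hj => absurd hj (Finset.notMem_empty j)⟩, h4⟩)
  have hW : P.What c = Submodule.span K (Set.range fun i =>
      ((P.relCoset c).submoduleOf (P.Scoset c)).mkQ ⟨v i, hv i⟩) := by
    apply le_antisymm
    · rw [What, Submodule.span_le]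
      rintro _ ⟨⟨s, hs⟩, ⟨u, hu, hint, hsu⟩, rfl⟩
      obtain ⟨h1, h2⟩ := (P.mem_M_iff hβ).1 hu.1
      have h3 := (P.mem_interior_cone_iff hβ h1).1 hint
      -- For spanning, an interior monomial is reduced in the complex with full $Z$, so that the
      -- remainder involves interior box points only.
      have hx := P.single_mem_cochains (β := β) (Z := Finset.univ) (Γ := Γ) (J := Finset.univ)
        (s := mono u) (Submodule.subset_span ⟨u, ⟨h1, hu.2, h2, fun j _ _ => h3 j⟩, rfl⟩)
      rw [Finset.card_univ, Fintype.card_fin] at hx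
      obtain ⟨y, hy, hxy⟩ := P.exists_sub_nabla_mem hβ hΓ hx
      rw [Pi.sub_apply, Pi.single_eq_same] at hxy
      have hr : P.nabla β y Finset.univ ∈ P.relCoset c := by
        rw [nabla, koszulD_apply]
        refine Submodule.sum_mem _ fun j _ => Submodule.smul_mem _ _
          (P.Dtilde_mem_relCoset j ?_)
        have := (P.mem_cochains.1 hy (Finset.univ.erase j)).1 (by
          rw [Finset.card_erase_of_mem (Finset.mem_univ j), Finset.card_univ, Fintype.card_fin])
        rw [P.Scoset_eq_piece hβ c Finset.univ]
        refine Submodule.span_mono (Set.image_mono ?_) this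
        rintro w ⟨w1, w2, w3, _⟩
        exact ⟨w1, w2, w3, fun j _ hj => absurd hj (Finset.notMem_empty j)⟩
      simp only at hsu
      subst hsu
      exact mkQ_mem_span hv (P.relCoset_le_Scoset hβ c) hs hr (by rwa [hrange])
    · rw [Submodule.span_le]
      rintro _ ⟨b, rfl⟩
      refine Submodule.subset_span ⟨_, ⟨b.1, hXM b.1 b.2, ?_, rfl⟩, rfl⟩
      exact (P.mem_interior_cone_iff hβ b.2.1.1).2 fun j =>
        b.2.1.2.2.2 j (Finset.mem_univ j) (Finset.mem_univ j)
  rw [hW, rank_span hLI, Cardinal.mk_range_eq _ hLI.injective, Set.cast_ncard hXfin]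

end

end Data

end Delsarte

end

theorem theorem9p9 {m n : ℕ} (P : Delsarte.Data m n) :
    -- the set of lattice points of the parallelepiped is finite, so the counts below are genuine
    P.latticeB.Finite ∧
    (∀ β : Matrix (Fin m) (Fin n) ℚ, β * P.alpha = 1 →
      -- the Koszul complex of the operators, and its subcomplex
      (P.nabla β ∘ₗ P.nabla β = 0 ∧
        (∀ k, (P.kos k).map (P.nabla β) ≤ P.kos (k + 1)) ∧
        (∀ k, P.kAA k ≤ P.kos k) ∧
        (∀ k, (P.kAA k).map (P.nabla β) ≤ P.kAA (k + 1))) ∧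
      -- acyclicity below degree `m`
      (∀ i < m, Subsingleton (P.H β i)) ∧
      -- the dimension of the top cohomology
      Module.Finite Delsarte.K (P.H β m) ∧
      (Module.finrank Delsarte.K (P.H β m) : ℤ) =
        ∑ B : Finset (Fin m), (-1 : ℤ) ^ (Finset.univ \ B).card *
          ({b | b ∈ P.latticeB ∧ Delsarte.toReal b ∈ P.cone B}.ncard : ℤ) ∧
      Module.finrank Delsarte.K (P.H β m) =
        {b | b ∈ P.latticeB ∧
          Delsarte.toReal b ∈ P.interiorInV (P.cone Finset.univ)}.ncard) ∧
    -- the dimension of the interior subspace, for each coset of `ℤA₊` in the lattice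
    (∀ c ∈ P.VZ, Module.rank Delsarte.K (P.What c) = (P.R c : Cardinal)) := by
  obtain ⟨β₀, hβ₀⟩ := P.exists_mul_alpha_eq_one
  refine ⟨P.latticeB_finite hβ₀, fun β hβ => ⟨⟨P.nabla_mul_self hβ, fun k => ?_, P.kAA_le_kos,
    fun k => ?_⟩, fun i hi => P.subsingleton_H hβ hi, (P.finite_and_finrank_H hβ).1, ?_,
    (P.finite_and_finrank_H hβ).2⟩, fun c _ => P.rank_What hβ₀ c⟩
  · rw [P.kos_eq hβ, P.kos_eq hβ]
    exact P.map_nabla_cochains_le hβ P.univ_add_mem k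
  · rw [P.kAA_eq hβ, P.kAA_eq hβ]
    exact P.map_nabla_cochains_le hβ P.univ_add_mem k
  · rw [(P.finite_and_finrank_H hβ).2, P.sum_ncard_cone_eq hβ]
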